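/- **Conventions.** Let $K$ be a field. Costs count field operations ($+,-,\times,\div$, one unit each) of straight-line programs over $K$; a program may depend on the index data below (block boundaries, $\{0,1\}$-matrices, permutations) but not on the field elements, and handling indices and copying are not charged. Let $2\le\omega\le 3$ and $c$ be real numbers such that, for every $n$, two $n\times n$ matrices over $K$ can be multiplied in at most $c\,n^{\omega}$ operations. Let $s\ge 1$. An $n\times n$ matrix $M$ is *$s$-quasiseparable* if $\operatorname{rank}(M_{k+1..n,1..k})\le s$ and $\operatorname{rank}(M_{1..k,k+1..n})\le s$ for all $1\le k\le n-1$. For an $n\times n$ matrix $A$, $\mathrm{Left}(A)$ keeps the entries $A_{i,j}$ with $i+j\le n$ and replaces the others by $0$; $A$ is *left triangular* if $A=\mathrm{Left}(A)$, and it is then called $s$-quasiseparable if all its leading $k\times(n-k)$ submatrices, $1\le k\le n-1$, have rank at most $s$. A *Compact Bruhat representation* of an $s$-quasiseparable left triangular $n\times n$ matrix $A$ consists, for some $r$, of matrices $D^C,S^C$ ($n\times r$), $D^E,S^E$ ($r\times n$), of $r\times r$ $\{0,1\}$-matrices $T^C,T^E$ such that $T^C$ and $(T^E)^T$ are lower triangular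 with exactly one $1$ in each row, and of an $r\times r$ permutation matrix $R$, such that $C=D^C+S^CT^C$ is in column echelon form without zero columns, $E=D^E+T^ES^E$ is in row echelon form without zero rows, and $A=\mathrm{Left}(CRE)$. Here $D^C$ and $(D^E)^T$ are block diagonal, and $S^C$ and $(S^E)^T$ block sub-diagonal (nonzero only in the blocks immediately below the block diagonal), with respect to a cutting of the columns into consecutive slices of width $s$ (the last one possibly narrower) and of the rows into as many consecutive blocks; $C$ and $E^T$ may use different cuttings of the rows. A Compact Bruhat representation of an $s$-quasiseparable $n\times n$ matrix $M$ consists of such representations of the left triangular matrices $\mathrm{Left}(J_nM)$ and $\mathrm{Left}(MJ_n)$, where $J_n$ is the unit anti-diagonal matrix, together with the diagonal of $M$. **Statement.** There is a constant $\mathcal C>0$ depending only on $\omega$ and $c$ such that, for all such $K$, $n$ and $s$, an $s$-quasiseparable $n\times n$ matrix over $K$ given in Compact Bruhat representation can be multiplied 1. by a vector in at most $\mathcal C\,ns$ operations; 2. by a dense $n\times m$ matrix in at most $\mathcal C\,s^{\omega-2}nm$ operations if $m\ge s$, and by a dense tall and skinny $n\times t$ matrix, $t\le s$, in at most $\mathcal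 C\,st^{\omega-2}n$ operations; 3. by another $s$-quasiseparable matrix in Compact Bruhat representation in at most $\mathcal C\,s^{\omega-2}n^2$ operations (the product being output as a dense matrix). Moreover, an $s$-quasiseparable left triangular matrix given in Compact Bruhat representation can be multiplied by a dense $n\times t$ matrix in at most $\mathcal C\,st^{\omega-2}n$ operations if $t\le s$, and in at most $\mathcal C\,nts^{\omega-2}$ operations if $t\ge s$. -/

import Mathlib

/-! ### Counting field operations: straight-line programs

An algorithm over a field `K` is a straight-line program. Each instruction performs one of the four
field operations on operands that are constants, inputs, or results of earlier instructions, and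
costs one. A division by zero makes the program fail. -/

/-- The four field operations. -/
inductive FieldOp where
  | add
  | sub
  | mul
  | div

/-- An operand: a constant, an input, or the result of the `j`-th instruction (from `0`). -/
inductive Operand (K ι : Type*) where
  | const (a : K)
  | input (i : ι)
  | result (j : ℕ)

/-- One instruction, that is, one field operation. -/
structure Instruction (K ι : Type*) where
  op : FieldOp
  fst : Operand K ι
  snd : Operand K ι

/-- A straight-line program with inputs indexed by `ι` and outputs indexed by `κ`. -/
structure SLP (K ι κ : Type*) where
  code : List (Instruction K ι)
  out : κ → Operand K ι

open Classical in
/-- The value of a field operation, undefined for a division by zero. -/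
noncomputable def FieldOp.apply {K : Type*} [Field K] : FieldOp → K → K → Option K
  | .add, a, b => some (a + b)
  | .sub, a, b => some (a - b)
  | .mul, a, b => some (a * b)
  | .div, a, b => if b = 0 then none else some (a / b)

/-- The value of an operand on the input `x` when `w` lists the results obtained so far. -/
def Operand.value {K ι : Type*} (x : ι → K) (w : List K) : Operand K ι → Option K
  | .const a => some a
  | .input i => some (x i)
  | .result j => w[j]?

/-- The value computed by one instruction. -/
noncomputable def Instruction.exec {K ι : Type*} [Field K] (x : ι → K) (w : List K)
    (I : Instruction K ι) : Option K :=
  (I.fst.value x w).bind fun a => (I.snd.value x w).bind fun b => I.op.apply a b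

/-- Run a list of instructions on the input `x`, appending each result to the list `w`. -/
noncomputable def runCode {K ι : Type*} [Field K] (x : ι → K) :
    List (Instruction K ι) → List K → Option (List K)
  | [], w => some w
  | I :: P, w => (I.exec x w).bind fun a => runCode x P (w ++ [a])

/-- The number of field operations performed by a program. -/
def SLP.size {K ι κ : Type*} (P : SLP K ι κ) : ℕ := P.code.length

/-- On the input `x` the program `P` runs without failure and its outputs are `y`. -/
def SLP.Outputs {K ι κ : Type*} [Field K] (P : SLP K ι κ) (x : ι → K) (y : κ → K) : Prop :=
  ∃ w : List K, runCode x P.code [] = some w ∧ ∀ k, (P.out k).value x w = some (y k)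

/-- The entries of a matrix as a family indexed by pairs. -/
def entries {K ι κ : Type*} (A : Matrix ι κ K) : ι × κ → K := fun p => A p.1 p.2

/-- Two `n × n` matrices over `K` can be multiplied in at most `c * n ^ ω` field operations,
for every `n`. -/
def MatMulIn (K : Type*) [Field K] (ω c : ℝ) : Prop :=
  ∀ n : ℕ, ∃ P : SLP K ((Fin n × Fin n) ⊕ (Fin n × Fin n)) (Fin n × Fin n),
    (P.size : ℝ) ≤ c * (n : ℝ) ^ ω ∧
    ∀ A B : Matrix (Fin n) (Fin n) K,
      P.Outputs (Sum.elim (entries A) (entries B)) (entries (A * B))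

/-! ### Quasiseparable and left triangular matrices -/

/-- `M` is `(rL, rU)`-quasiseparable: for `1 ≤ k ≤ n - 1` the block of the rows `> k` and columns
`≤ k` has rank at most `rL`, that of the rows `≤ k` and columns `> k` rank at most `rU`. -/
def IsQuasiseparable {K : Type*} [Field K] {n : ℕ} (rL rU : ℕ)
    (M : Matrix (Fin n) (Fin n) K) : Prop :=
  ∀ k : ℕ, 1 ≤ k → k < n →
    (M.submatrix (Subtype.val : {i : Fin n // k ≤ i.val} → Fin n)
      (Subtype.val : {j : Fin n // j.val < k} → Fin n)).rank ≤ rL ∧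
    (M.submatrix (Subtype.val : {i : Fin n // i.val < k} → Fin n)
      (Subtype.val : {j : Fin n // k ≤ j.val} → Fin n)).rank ≤ rU

/-- The left triangular part: the entries strictly above the main anti-diagonal are kept
(`i + j ≤ n` for indices counted from one). -/
def leftPart {K : Type*} [Field K] {n : ℕ} (A : Matrix (Fin n) (Fin n) K) :
    Matrix (Fin n) (Fin n) K :=
  Matrix.of fun i j => if i.val + j.val + 2 ≤ n then A i j else 0

/-- `A` is left triangular: zero on and below the main anti-diagonal. -/
def IsLeftTriangular {K : Type*} [Field K] {n : ℕ} (A : Matrix (Fin n) (Fin n) K) : Prop :=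
  ∀ i j : Fin n, n < i.val + j.val + 2 → A i j = 0

/-- A left triangular matrix is `s`-quasiseparable: its leading `k × (n - k)` submatrices,
`1 ≤ k ≤ n - 1`, have rank at most `s`. -/
def IsLeftQuasiseparable {K : Type*} [Field K] {n : ℕ} (s : ℕ)
    (A : Matrix (Fin n) (Fin n) K) : Prop :=
  ∀ k : ℕ, 1 ≤ k → k < n →
    (A.submatrix (Subtype.val : {i : Fin n // i.val < k} → Fin n)
      (Subtype.val : {j : Fin n // j.val < n - k} → Fin n)).rank ≤ s

/-- The unit anti-diagonal matrix `J_n`. -/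
def unitAntidiag (n : ℕ) (K : Type*) [Field K] : Matrix (Fin n) (Fin n) K :=
  Matrix.of fun i j => if j = i.rev then 1 else 0

/-- `C` is in column echelon form, without zero columns: the row indices of the leading
coefficients of the columns are strictly increasing. -/
def IsColumnEchelon {K : Type*} [Field K] {n r : ℕ} (C : Matrix (Fin n) (Fin r) K) : Prop :=
  ∃ p : Fin r → Fin n, StrictMono p ∧ ∀ j, C (p j) j ≠ 0 ∧ ∀ i, i < p j → C i j = 0

/-- `E` is in row echelon form, without zero rows. -/
def IsRowEchelon {K : Type*} [Field K] {n r : ℕ} (E : Matrix (Fin r) (Fin n) K) : Prop :=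
  IsColumnEchelon E.transpose

/-! ### The Compact Bruhat representation -/

/-- The index data of a decomposition `D + S * T` of an `n × r` matrix. The columns are cut into
consecutive slices of width `s` (the last one may be narrower), column `j` (from `0`) lying in
slice `j / s`. The rows are cut into as many consecutive blocks; `rowBlock i` is the number, from
`0`, of the block of row `i`. The `{0,1}`-matrix `T`, lower triangular with exactly one `1` in each
row, has that of row `k` in column `fold k`. -/
structure BidiagShape (n r s : ℕ) where
  rowBlock : Fin n → ℕ
  rowBlock_mono : Monotone rowBlock
  rowBlock_bound : ∀ i, rowBlock i = 0 ∨ rowBlock i * s < r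
  fold : Fin r → Fin r
  fold_le : ∀ k, fold k ≤ k

/-- The `{0,1}`-matrix `T`. -/
def BidiagShape.T {n r s : ℕ} (β : BidiagShape n r s) (K : Type*) [Field K] :
    Matrix (Fin r) (Fin r) K :=
  Matrix.of fun k l => if l = β.fold k then 1 else 0

/-- `D = Diag(D_1, …, D_t)`. -/
def BidiagShape.IsBlockDiag {n r s : ℕ} (β : BidiagShape n r s) {K : Type*} [Field K]
    (D : Matrix (Fin n) (Fin r) K) : Prop :=
  ∀ i j, D i j ≠ 0 → β.rowBlock i = j.val / s

/-- `S` is block sub-diagonal: its blocks `S_2, …, S_t` are just below the block diagonal. -/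
def BidiagShape.IsBlockSubdiag {n r s : ℕ} (β : BidiagShape n r s) {K : Type*} [Field K]
    (S : Matrix (Fin n) (Fin r) K) : Prop :=
  ∀ i j, S i j ≠ 0 → β.rowBlock i = j.val / s + 1

/-- The index data of a Compact Bruhat representation of an `n × n` left triangular matrix: the
number `r` of pivots, the index data of `C` and of the transpose of `E`, the permutation `R`. -/
structure CBShape (n s : ℕ) where
  r : ℕ
  col : BidiagShape n r s
  row : BidiagShape n r s
  perm : Equiv.Perm (Fin r)

/-- The positions of the field elements stored in the four matrices `D^C`, `S^C`, `D^E`, `S^E`. -/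
inductive CBEntry {n s : ℕ} (σ : CBShape n s) where
  | DC (i : Fin n) (j : Fin σ.r)
  | SC (i : Fin n) (j : Fin σ.r)
  | DE (i : Fin σ.r) (j : Fin n)
  | SE (i : Fin σ.r) (j : Fin n)

/-- `C = D^C + S^C * T^C`. -/
def CBShape.C {n s : ℕ} (σ : CBShape n s) {K : Type*} [Field K] (X : CBEntry σ → K) :
    Matrix (Fin n) (Fin σ.r) K :=
  Matrix.of (fun i j => X (.DC i j)) + Matrix.of (fun i j => X (.SC i j)) * σ.col.T K

/-- `E = D^E + T^E * S^E`, where the transpose of `T^E` is lower triangular. -/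
def CBShape.E {n s : ℕ} (σ : CBShape n s) {K : Type*} [Field K] (X : CBEntry σ → K) :
    Matrix (Fin σ.r) (Fin n) K :=
  Matrix.of (fun i j => X (.DE i j)) +
    (σ.row.T K).transpose * Matrix.of (fun i j => X (.SE i j))

/-- The field elements `X`, with the index data `σ`, are a Compact Bruhat representation of the
`s`-quasiseparable left triangular matrix `A`. -/
structure IsLeftCompactBruhat {n s : ℕ} (σ : CBShape n s) {K : Type*} [Field K]
    (X : CBEntry σ → K) (A : Matrix (Fin n) (Fin n) K) : Prop where
  leftTriangular : IsLeftTriangular A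
  quasiseparable : IsLeftQuasiseparable s A
  blockDiag_C : σ.col.IsBlockDiag (Matrix.of fun i j => X (.DC i j))
  blockSubdiag_C : σ.col.IsBlockSubdiag (Matrix.of fun i j => X (.SC i j))
  blockDiag_E : σ.row.IsBlockDiag (Matrix.of fun j i => X (.DE i j))
  blockSubdiag_E : σ.row.IsBlockSubdiag (Matrix.of fun j i => X (.SE i j))
  echelon_C : IsColumnEchelon (σ.C X)
  echelon_E : IsRowEchelon (σ.E X)
  eq_leftPart : A = leftPart (σ.C X * σ.perm.permMatrix K * σ.E X)

/-- The index data of a Compact Bruhat representation of an `n × n` matrix `M`: those for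
`Left (J * M)` and `Left (M * J)`, the strictly lower and upper triangular parts. -/
structure QSShape (n s : ℕ) where
  lower : CBShape n s
  upper : CBShape n s

/-- The positions of the field elements stored for `M`: those of its two triangular parts, and the
main diagonal. -/
inductive QSEntry {n s : ℕ} (σ : QSShape n s) where
  | lower (e : CBEntry σ.lower)
  | upper (e : CBEntry σ.upper)
  | diag (i : Fin n)

/-- The field elements `X`, with the index data `σ`, are a Compact Bruhat representation of the
`s`-quasiseparable matrix `M`. -/
structure IsCompactBruhat {n s : ℕ} (σ : QSShape n s) {K : Type*} [Field K]
    (X : QSEntry σ → K) (M : Matrix (Fin n) (Fin n) K) : Prop where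
  quasiseparable : IsQuasiseparable s s M
  lower : IsLeftCompactBruhat σ.lower (fun e => X (.lower e)) (leftPart (unitAntidiag n K * M))
  upper : IsLeftCompactBruhat σ.upper (fun e => X (.upper e)) (leftPart (M * unitAntidiag n K))
  diag : ∀ i, X (.diag i) = M i i

/-! Write `A = Left(C R E)`. A row of `C` in block `a` is nonzero only in slice `a` and in the image
under `fold` of slice `a - 1`. So each row of `C`, and likewise each column of `E`, has its support
in a set of at most `2 * min s r` pivots that depends only on its block. Forming `C` and `E` takes
additions only, at most `n * min s r` for each, and `R` merely relabels the rows of `E`.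

Put `s' = min s n` and `h = min s' t`. The columns are cut into `O(n / h)` chunks of at most `h`
consecutive indices, the rows into their mirror images, so finely that the row block of `E` and that
of `C` are constant on each chunk. For the rows mirrored to chunk `k`, `Left` keeps all columns of
the earlier chunks, a triangle of chunk `k` itself, and nothing later. Hence the product with `B` on
these rows is `C` times a prefix sum of `E * B`, plus a triangular block of `C * E` times a chunk of
`B`. By the support bound, updating the prefix sum touches at most `2 * s'` of its rows, and every
matrix product involved has dimensions among `h`, `2 * s'` and `t`. Block multiplication with blocks
of size `h` bounds the cost of each chunk by a multiple of `s' * h * t * h ^ (ω - 3)`. The sum is a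
multiple of `n * s' * t * h ^ (ω - 3)`, which is `productCost`, because `s' * t = max s' t * h`.
This is `MatMulIn.leftProduct` together with `leftProduct_cost_le`.

A quasiseparable matrix is its diagonal plus two flipped left triangular matrices. For a product of
two of them, the right factor is first made dense by multiplying it by the identity.

Costs are handled through `Computes`, about functions on the set `Ω` of admissible inputs;
`SLP.computes` and `Computes.exists_slp` translate from and to programs. -/

/-! ### Costs of families of values

The possible inputs of a program are indexed by a type `Ω`, and a quantity depending on the input is
a function `Ω → K`. -/

/-- The values that can be used as operands when those in `F` are known: these and the constants. -/
def avail {Ω K : Type*} (F : Set (Ω → K)) : Set (Ω → K) :=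
  F ∪ Set.range fun a _ => a

/-- All the values in `G` can be obtained from those in `F` in at most `x` field operations. -/
inductive Computes {Ω K : Type*} [Field K] : Set (Ω → K) → ℝ → Set (Ω → K) → Prop
  | done {F G : Set (Ω → K)} {x : ℝ} : 0 ≤ x → G ⊆ avail F → Computes F x G
  | step {F G : Set (Ω → K)} {x : ℝ} {a b f : Ω → K} (op : FieldOp) : a ∈ avail F → b ∈ avail F →
      (∀ o, op.apply (a o) (b o) = some (f o)) → Computes (insert f F) x G → Computes F (x + 1) G

section avail

variable {Ω K : Type*} {F G : Set (Ω → K)}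

theorem subset_avail : F ⊆ avail F := Set.subset_union_left

theorem const_mem_avail (a : K) : (fun _ : Ω => a) ∈ avail F := Or.inr ⟨a, rfl⟩

theorem avail_mono (h : F ⊆ G) : avail F ⊆ avail G := Set.union_subset_union_left _ h

theorem avail_subset_iff : avail F ⊆ avail G ↔ F ⊆ avail G :=
  ⟨subset_avail.trans, fun h => Set.union_subset h Set.subset_union_right⟩

theorem avail_eq_univ [IsEmpty Ω] [Zero K] : avail F = Set.univ :=
  Set.eq_univ_of_forall fun _ => Or.inr ⟨0, funext fun o => isEmptyElim o⟩

end avail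

namespace Computes

variable {Ω K : Type*} [Field K] {F F' G H : Set (Ω → K)} {x y : ℝ}

theorem nonneg (h : Computes F x G) : 0 ≤ x := by
  induction h with
  | done h _ => exact h
  | step _ _ _ _ _ ih => linarith

theorem mono_left (h : Computes F x G) (hF : F ⊆ avail F') : Computes F' x G := by
  induction h generalizing F' with
  | done h hG => exact done h (hG.trans (avail_subset_iff.2 hF))
  | step op ha hb hf _ ih =>
    refine step op (avail_subset_iff.2 hF ha) (avail_subset_iff.2 hF hb) hf (ih ?_)
    exact Set.insert_subset (subset_avail (Set.mem_insert _ _))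
      (hF.trans (avail_mono (Set.subset_insert _ _)))

theorem mono_right (h : Computes F x G) (hG : H ⊆ avail G) : Computes F x H := by
  induction h with
  | done h hG' => exact done h (hG.trans (avail_subset_iff.2 hG'))
  | step op ha hb hf _ ih => exact step op ha hb hf (ih hG)

theorem mono_cost (h : Computes F x G) (hxy : x ≤ y) : Computes F y G := by
  induction h generalizing y with
  | done h hG => exact done (h.trans hxy) hG
  | step op ha hb hf _ ih =>
    have := step op ha hb hf (ih (le_sub_iff_add_le.2 hxy))
    rwa [sub_add_cancel] at this

theorem union_left (h : Computes F x G) : Computes F x (F ∪ G) := by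
  induction h with
  | done h hG => exact done h (Set.union_subset subset_avail hG)
  | step op ha hb hf _ ih =>
    refine step op ha hb hf (ih.mono_right (subset_avail.trans (avail_mono ?_)))
    exact Set.union_subset_union_left _ (Set.subset_insert _ _)

theorem trans (h : Computes F x G) (h' : Computes (F ∪ G) y H) :
    Computes F (x + y) (G ∪ H) := by
  induction h with
  | done h hG =>
    refine (h'.union_left.mono_left (Set.union_subset subset_avail hG)).mono_cost
      (le_add_of_nonneg_left h) |>.mono_right ?_
    rw [Set.union_assoc]
    exact Set.subset_union_right.trans subset_avail
  | @step F G x a b f op ha hb hf _ ih =>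
    rw [add_right_comm]
    refine step op ha hb hf (ih (h'.mono_left ?_))
    exact (Set.union_subset_union_left _ (Set.subset_insert _ _)).trans subset_avail

theorem trans' (h : Computes F x G) (h' : Computes (F ∪ G) y H) : Computes F (x + y) H :=
  (h.trans h').mono_right (Set.subset_union_right.trans subset_avail)

theorem union (h : Computes F x G) (h' : Computes F y H) : Computes F (x + y) (G ∪ H) :=
  h.trans (h'.mono_left (Set.subset_union_left.trans subset_avail))

theorem of_subset (h : G ⊆ avail F) : Computes F 0 G := done le_rfl h

/-- Without any admissible input every value is a constant function, hence free. -/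
theorem of_isEmpty [IsEmpty Ω] (hx : 0 ≤ x) : Computes F x G :=
  done hx (avail_eq_univ (F := F) ▸ Set.subset_univ _)

theorem biUnion {α : Type*} (s : Finset α) {x : α → ℝ} {G : α → Set (Ω → K)}
    (h : ∀ a ∈ s, Computes F (x a) (G a)) : Computes F (∑ a ∈ s, x a) (⋃ a ∈ s, G a) := by
  classical
  induction s using Finset.induction_on with
  | empty => simpa using of_subset (Set.empty_subset _)
  | insert a s ha ih =>
    rw [Finset.sum_insert ha, Finset.set_biUnion_insert]
    exact (h a (Finset.mem_insert_self _ _)).union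
      (ih fun b hb => h b (Finset.mem_insert_of_mem hb))

theorem iUnion {α : Type*} [Fintype α] {x : ℝ} {G : α → Set (Ω → K)}
    (h : ∀ a, Computes F x (G a)) : Computes F (Fintype.card α * x) (⋃ a, G a) := by
  simpa using biUnion Finset.univ fun a _ => h a

theorem range {α : Type*} [Fintype α] {f : α → Ω → K}
    (h : ∀ a, Computes F x {f a}) : Computes F (Fintype.card α * x) (Set.range f) := by
  simpa using iUnion h

theorem add {a b : Ω → K} (ha : a ∈ avail F) (hb : b ∈ avail F) : Computes F 1 {a + b} := by
  have := step (x := 0) (G := {a + b}) .add ha hb (f := a + b) (fun _ => rfl)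
    (of_subset (by simpa using subset_avail (Set.mem_insert _ _)))
  rwa [zero_add] at this

theorem mul {a b : Ω → K} (ha : a ∈ avail F) (hb : b ∈ avail F) : Computes F 1 {a * b} := by
  have := step (x := 0) (G := {a * b}) .mul ha hb (f := a * b) (fun _ => rfl)
    (of_subset (by simpa using subset_avail (Set.mem_insert _ _)))
  rwa [zero_add] at this

/-- Adding finitely many terms, each of them to one member of a family. -/
theorem scatter_add {α ι : Type*} [DecidableEq ι] (s : Finset α) (φ : α → ι)
    {g : ι → Ω → K} {z : α → Ω → K} (hg : ∀ p, g p ∈ avail F) (hz : ∀ a ∈ s, z a ∈ avail F) :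
    Computes F s.card (Set.range fun p => g p + ∑ a ∈ s with φ a = p, z a) := by
  classical
  induction s using Finset.induction_on with
  | empty => simpa using of_subset (Set.range_subset_iff.2 hg)
  | insert a s ha ih =>
    have h1 := ih fun b hb => hz b (Finset.mem_insert_of_mem hb)
    have h2 : Computes (F ∪ Set.range fun p => g p + ∑ a ∈ s with φ a = p, z a) 1
        {(g (φ a) + ∑ b ∈ s with φ b = φ a, z b) + z a} :=
      add (subset_avail (Or.inr ⟨_, rfl⟩))
        (avail_mono Set.subset_union_left (hz a (Finset.mem_insert_self _ _)))
    rw [Finset.card_insert_of_notMem ha, Nat.cast_add, Nat.cast_one]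
    refine (h1.trans h2).mono_right ?_
    rintro _ ⟨p, rfl⟩
    apply subset_avail
    by_cases hp : φ a = p
    · subst hp
      right
      simp [Finset.filter_insert, ha, add_comm, add_left_comm]
    · left
      exact ⟨p, by simp [Finset.filter_insert, hp]⟩

end Computes

/-! ### Straight-line programs and costs -/

section SLP

variable {Ω K ι : Type*}

theorem Operand.value_append {x : ι → K} {w v : List K} {u : Operand K ι} {a : K}
    (h : u.value x w = some a) : u.value x (w ++ v) = some a := by
  cases u with
  | const b => exact h
  | input i => exact h
  | result j =>
    have hj : j < w.length := (List.getElem?_eq_some_iff.1 h).1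
    exact (List.getElem?_append_left hj).trans h

/-- The history of a run is read as a list `L` of functions on `Ω`, evaluated at the input. One
successful evaluation, hence one input, is needed to know that a result index lies within `L`. -/
theorem Operand.exists_avail [Nonempty Ω] {inp : Ω → ι → K} {F : Set (Ω → K)}
    (hF : ∀ i, (fun o => inp o i) ∈ avail F) {L : List (Ω → K)} (hL : ∀ f ∈ L, f ∈ avail F)
    {u : Operand K ι} (hu : ∀ o, ∃ a, u.value (inp o) (L.map fun f => f o) = some a) :
    ∃ f ∈ avail F, ∀ o, u.value (inp o) (L.map fun f => f o) = some (f o) := by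
  cases u with
  | const a => exact ⟨_, const_mem_avail a, fun o => rfl⟩
  | input i => exact ⟨_, hF i, fun o => rfl⟩
  | result j =>
    obtain ⟨a, ha⟩ := hu (Classical.arbitrary Ω)
    have hj : j < L.length := by simpa using (List.getElem?_eq_some_iff.1 ha).1
    exact ⟨L[j], hL _ (List.getElem_mem hj), fun o => by simp [Operand.value, hj]⟩

variable [Field K]

/-- Each `step` becomes one instruction. The histories `w o` share the length `L`, so that the new
result has the same address `L` for every input. -/
theorem Computes.exists_code {inp : Ω → ι → K} {F G : Set (Ω → K)} {x : ℝ} (h : Computes F x G)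
    (w : Ω → List K) (L : ℕ) (hL : ∀ o, (w o).length = L)
    (hF : ∀ f ∈ F, ∃ u : Operand K ι, ∀ o, u.value (inp o) (w o) = some (f o)) :
    ∃ P : List (Instruction K ι), (P.length : ℝ) ≤ x ∧ ∃ w' : Ω → List K,
      (∀ o, runCode (inp o) P (w o) = some (w' o)) ∧
      ∀ f ∈ G, ∃ u : Operand K ι, ∀ o, u.value (inp o) (w' o) = some (f o) := by
  have avl : ∀ {F : Set (Ω → K)} {w : Ω → List K},
      (∀ f ∈ F, ∃ u : Operand K ι, ∀ o, u.value (inp o) (w o) = some (f o)) →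
      ∀ f ∈ avail F, ∃ u : Operand K ι, ∀ o, u.value (inp o) (w o) = some (f o) := by
    rintro F w hF f (hf | ⟨a, rfl⟩)
    · exact hF f hf
    · exact ⟨.const a, fun o => rfl⟩
  induction h generalizing w L with
  | done hx hG =>
    exact ⟨[], by simpa using hx, w, fun o => rfl, fun f hf => avl hF f (hG hf)⟩
  | @step F G x a b f op ha hb hf _ ih =>
    obtain ⟨ua, hua⟩ := avl hF a ha
    obtain ⟨ub, hub⟩ := avl hF b hb
    obtain ⟨P, hP, w', hw', hG⟩ := ih (fun o => w o ++ [f o]) (L + 1) (by simp [hL]) (by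
      rintro g (rfl | hg)
      · exact ⟨.result L, fun o => by simp [Operand.value, ← hL o]⟩
      · obtain ⟨u, hu⟩ := hF g hg
        exact ⟨u, fun o => Operand.value_append (hu o)⟩)
    refine ⟨⟨op, ua, ub⟩ :: P, by simpa using hP, w', fun o => ?_, hG⟩
    simp [runCode, Instruction.exec, hua, hub, hf, hw']

theorem Computes.exists_slp {κ : Type*} {inp : Ω → ι → K} {F : Set (Ω → K)} {x : ℝ}
    {y : κ → Ω → K} (h : Computes F x (Set.range y)) (hF : ∀ f ∈ F, ∃ i, (fun o => inp o i) = f) :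
    ∃ P : SLP K ι κ, (P.size : ℝ) ≤ x ∧ ∀ o, P.Outputs (inp o) (fun k => y k o) := by
  obtain ⟨P, hP, w', hw', hG⟩ := h.exists_code (inp := inp) (fun _ => []) 0 (fun _ => rfl) (by
    intro f hf
    obtain ⟨i, rfl⟩ := hF f hf
    exact ⟨.input i, fun o => rfl⟩)
  choose u hu using fun k => hG (y k) ⟨k, rfl⟩
  exact ⟨⟨P, u⟩, hP, fun o => ⟨w' o, hw' o, fun k => hu k o⟩⟩

theorem computes_of_runCode [Nonempty Ω] {inp : Ω → ι → K} {F G : Set (Ω → K)}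
    (hF : ∀ i, (fun o => inp o i) ∈ avail F) {L : List (Ω → K)} (hL : ∀ f ∈ L, f ∈ avail F)
    {P : List (Instruction K ι)} {w : Ω → List K}
    (hw : ∀ o, runCode (inp o) P (L.map fun f => f o) = some (w o))
    (hG : ∀ f ∈ G, ∃ u : Operand K ι, ∀ o, u.value (inp o) (w o) = some (f o)) :
    Computes F P.length G := by
  induction P generalizing F L with
  | nil =>
    refine .done (by simp) fun f hf => ?_
    obtain ⟨u, hu⟩ := hG f hf
    have hw' : ∀ o, w o = L.map fun f => f o := fun o => (Option.some.inj (hw o)).symm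
    simp only [hw'] at hu
    obtain ⟨g, hg, hgu⟩ := Operand.exists_avail hF hL fun o => ⟨_, hu o⟩
    have : f = g := funext fun o => Option.some.inj ((hu o).symm.trans (hgu o))
    exact this ▸ hg
  | cons I P ih =>
    simp only [runCode, Instruction.exec, Option.bind_eq_some_iff] at hw
    choose f h hf using hw
    choose a ha b hb hab using h
    obtain ⟨a', ha', hau⟩ := Operand.exists_avail hF hL fun o => ⟨_, ha o⟩
    obtain ⟨b', hb', hbu⟩ := Operand.exists_avail hF hL fun o => ⟨_, hb o⟩
    have ea : a = a' := funext fun o => Option.some.inj ((ha o).symm.trans (hau o))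
    have eb : b = b' := funext fun o => Option.some.inj ((hb o).symm.trans (hbu o))
    subst ea eb
    rw [List.length_cons, Nat.cast_add, Nat.cast_one]
    refine .step I.op ha' hb' hab (ih (L := L ++ [f]) (fun i => ?_) ?_ (by simpa using hf))
    · exact avail_mono (Set.subset_insert _ _) (hF i)
    · intro g hg
      rcases List.mem_append.1 hg with hg | hg
      · exact avail_mono (Set.subset_insert _ _) (hL g hg)
      · rw [List.mem_singleton.1 hg]
        exact subset_avail (Set.mem_insert _ _)

theorem SLP.computes {κ : Type*} (P : SLP K ι κ) {inp : Ω → ι → K} {y : κ → Ω → K}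
    {F : Set (Ω → K)} (hF : ∀ i, (fun o => inp o i) ∈ avail F)
    (hP : ∀ o, P.Outputs (inp o) (fun k => y k o)) : Computes F P.size (Set.range y) := by
  rcases isEmpty_or_nonempty Ω with hΩ | hΩ
  · exact .of_isEmpty (Nat.cast_nonneg _)
  · choose w hw hout using hP
    refine computes_of_runCode hF (L := []) (by simp) (w := w) (by simpa using hw) ?_
    rintro _ ⟨k, rfl⟩
    exact ⟨P.out k, fun o => hout o k⟩

end SLP

/-! ### Matrix multiplication -/

/-- The entries of a matrix whose entries are values depending on the input. -/
def vals {Ω K ι κ : Type*} (A : Matrix ι κ (Ω → K)) : Set (Ω → K) :=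
  Set.range fun p : ι × κ => A p.1 p.2

theorem mem_vals {Ω K ι κ : Type*} (A : Matrix ι κ (Ω → K)) (i : ι) (j : κ) : A i j ∈ vals A :=
  ⟨(i, j), rfl⟩

theorem vals_subset_iff {Ω K ι κ : Type*} {A : Matrix ι κ (Ω → K)} {F : Set (Ω → K)} :
    vals A ⊆ F ↔ ∀ i j, A i j ∈ F :=
  Set.range_subset_iff.trans Prod.forall

theorem zero_mem_avail {Ω K : Type*} [Zero K] {F : Set (Ω → K)} : (0 : Ω → K) ∈ avail F :=
  const_mem_avail 0

/-- Extending a matrix by zeros to larger index types. -/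
noncomputable def extendByZero {R ι κ ι' κ' : Type*} [Zero R] (e₁ : ι → ι') (e₂ : κ → κ')
    (A : Matrix ι κ R) : Matrix ι' κ' R :=
  Function.extend e₁ (fun i => Function.extend e₂ (A i) 0) 0

section extendByZero

variable {R ι κ ι' κ' : Type*} [Zero R] {e₁ : ι → ι'} {e₂ : κ → κ'}

theorem extendByZero_apply (h₁ : Function.Injective e₁) (h₂ : Function.Injective e₂)
    (A : Matrix ι κ R) (i : ι) (j : κ) : extendByZero e₁ e₂ A (e₁ i) (e₂ j) = A i j := by
  rw [extendByZero, h₁.extend_apply, h₂.extend_apply]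

theorem extendByZero_apply_right (h₁ : Function.Injective e₁) (A : Matrix ι κ R) (i : ι) {y : κ'}
    (hy : y ∉ Set.range e₂) : extendByZero e₁ e₂ A (e₁ i) y = 0 := by
  rw [extendByZero, h₁.extend_apply, Function.extend_apply' _ _ _ hy, Pi.zero_apply]

theorem extendByZero_mem {S : Set R} (h0 : (0 : R) ∈ S) {A : Matrix ι κ R}
    (hA : ∀ i j, A i j ∈ S) (x : ι') (y : κ') : extendByZero e₁ e₂ A x y ∈ S := by
  classical
  unfold extendByZero Function.extend
  split_ifs
  · dsimp only
    split_ifs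
    · exact hA _ _
    · exact h0
  · exact h0

end extendByZero

/-- A block need not consist of consecutive indices, so counting suffices: `a < (a / h + 1) * h`. -/
theorem exists_embedding_blocks {α : Type*} [Fintype α] {a h : ℕ} (hh : 1 ≤ h)
    (hα : Fintype.card α ≤ a) : Nonempty (α ↪ Fin (a / h + 1) × Fin h) :=
  Function.Embedding.nonempty_of_card_le (by
    have := Nat.lt_div_mul_add (a := a) hh
    simp only [Fintype.card_prod, Fintype.card_fin]
    linarith)

theorem div_add_one_le {a h : ℕ} (hh : 1 ≤ h) (ha : h ≤ a) :
    ((a / h + 1 : ℕ) : ℝ) ≤ 2 * (a / h) := by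
  have h0 : (0 : ℝ) < h := by exact_mod_cast hh
  have h1 : ((a / h : ℕ) : ℝ) ≤ a / h := Nat.cast_div_le
  have h2 : (1 : ℝ) ≤ a / h := by rw [one_le_div h0]; exact_mod_cast ha
  push_cast
  linarith

namespace MatMulIn

variable {Ω K : Type*} [Field K] {ω c : ℝ} {F : Set (Ω → K)}

theorem nonneg (hM : MatMulIn K ω c) : 0 ≤ c := by
  obtain ⟨P, hP, -⟩ := hM 1
  have : (0 : ℝ) ≤ P.size := Nat.cast_nonneg _
  simpa using this.trans hP

theorem square (hM : MatMulIn K ω c) {h : ℕ} {A B : Matrix (Fin h) (Fin h) (Ω → K)}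
    (hA : vals A ⊆ avail F) (hB : vals B ⊆ avail F) :
    Computes F (c * (h : ℝ) ^ ω) (vals (A * B)) := by
  obtain ⟨P, hP, hout⟩ := hM h
  refine Computes.mono_cost ?_ hP
  refine P.computes (inp := fun o => Sum.elim (entries (A.map fun f => f o))
    (entries (B.map fun f => f o))) ?_ fun o => ?_
  · rintro (⟨i, j⟩ | ⟨i, j⟩)
    · exact hA (mem_vals A i j)
    · exact hB (mem_vals B i j)
  · convert hout (A.map fun f => f o) (B.map fun f => f o) using 1
    ext ⟨i, j⟩
    simp [entries, Matrix.mul_apply, Finset.sum_apply]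

/-- Products of matrices with index types of at most `a`, `b` and `d` elements, computed by
blocks of size `h`. -/
theorem rect (hM : MatMulIn K ω c) (hω : 2 ≤ ω) {ι κ τ : Type*} [Fintype ι] [Fintype κ]
    [Fintype τ] {a b d h : ℕ} (hh : 1 ≤ h) (ha : h ≤ a) (hb : h ≤ b) (hd : h ≤ d)
    (hι : Fintype.card ι ≤ a) (hκ : Fintype.card κ ≤ b) (hτ : Fintype.card τ ≤ d)
    {A : Matrix ι κ (Ω → K)} {B : Matrix κ τ (Ω → K)}
    (hA : vals A ⊆ avail F) (hB : vals B ⊆ avail F) :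
    Computes F ((8 * c + 2) * (a * b * d * (h : ℝ) ^ (ω - 3))) (vals (A * B)) := by
  classical
  obtain ⟨e₁⟩ := exists_embedding_blocks hh hι
  obtain ⟨e₂⟩ := exists_embedding_blocks hh hκ
  obtain ⟨e₃⟩ := exists_embedding_blocks hh hτ
  let A' := extendByZero e₁ e₂ A
  let B' := extendByZero e₂ e₃ B
  let A'' : Fin (a / h + 1) → Fin (b / h + 1) → Matrix (Fin h) (Fin h) (Ω → K) :=
    fun x y => Matrix.of fun u v => A' (x, u) (y, v)
  let B'' : Fin (b / h + 1) → Fin (d / h + 1) → Matrix (Fin h) (Fin h) (Ω → K) :=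
    fun x y => Matrix.of fun u v => B' (x, u) (y, v)
  have hprod : Computes F
      (Fintype.card (Fin (a / h + 1) × Fin (b / h + 1) × Fin (d / h + 1)) * (c * (h : ℝ) ^ ω))
      (⋃ p : Fin (a / h + 1) × Fin (b / h + 1) × Fin (d / h + 1),
        vals (A'' p.1 p.2.1 * B'' p.2.1 p.2.2)) := by
    refine Computes.iUnion fun p => hM.square (vals_subset_iff.2 fun u v => ?_)
      (vals_subset_iff.2 fun u v => ?_)
    · exact extendByZero_mem zero_mem_avail (vals_subset_iff.1 hA) _ _
    · exact extendByZero_mem zero_mem_avail (vals_subset_iff.1 hB) _ _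
  have hsum := Computes.scatter_add (F := F ∪ ⋃ p : Fin (a / h + 1) × Fin (b / h + 1) ×
      Fin (d / h + 1), vals (A'' p.1 p.2.1 * B'' p.2.1 p.2.2))
    (Finset.univ : Finset ((ι × τ) × Fin (b / h + 1))) Prod.fst (g := 0)
    (z := fun q => (A'' (e₁ q.1.1).1 q.2 * B'' q.2 (e₃ q.1.2).1) (e₁ q.1.1).2 (e₃ q.1.2).2)
    (fun _ => zero_mem_avail) (fun q _ => subset_avail (Or.inr (Set.mem_iUnion.2
      ⟨((e₁ q.1.1).1, q.2, (e₃ q.1.2).1), mem_vals _ _ _⟩)))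
  refine ((hprod.trans' hsum).mono_right (G := _) ?_).mono_cost ?_
  · refine vals_subset_iff.2 fun i j => subset_avail ⟨(i, j), ?_⟩
    have key : (A * B) i j = ∑ z : Fin (b / h + 1) × Fin h, A' (e₁ i) z * B' z (e₃ j) := by
      rw [Matrix.mul_apply]
      refine Fintype.sum_of_injective e₂ e₂.injective _ _ (fun z hz => ?_) fun k => ?_
      · rw [show A' (e₁ i) z = 0 from extendByZero_apply_right e₁.injective _ _ hz, zero_mul]
      · simp only [A', B', extendByZero_apply e₁.injective e₂.injective,
          extendByZero_apply e₂.injective e₃.injective]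
    simp only [Pi.zero_apply, zero_add, key, Fintype.sum_prod_type]
    rw [← Finset.univ_product_univ, Finset.sum_filter, Finset.sum_product, Finset.sum_comm]
    simp [Matrix.mul_apply, A'', B'']
  · have hc := hM.nonneg
    have h0 : (0 : ℝ) < h := by exact_mod_cast hh
    have h1 : (1 : ℝ) ≤ h := by exact_mod_cast hh
    have ea := div_add_one_le hh ha
    have eb := div_add_one_le hh hb
    have ed := div_add_one_le hh hd
    have hι' : (Fintype.card ι : ℝ) ≤ a := by exact_mod_cast hι
    have hτ' : (Fintype.card τ : ℝ) ≤ d := by exact_mod_cast hτ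
    have hpow : (h : ℝ) ^ ω = h ^ 3 * (h : ℝ) ^ (ω - 3) := by
      rw [← Real.rpow_natCast, ← Real.rpow_add h0]
      norm_num
    have hinv : (1 : ℝ) / h ≤ (h : ℝ) ^ (ω - 3) := by
      rw [one_div, ← Real.rpow_neg_one]
      exact Real.rpow_le_rpow_of_exponent_le h1 (by linarith)
    simp only [Fintype.card_prod, Fintype.card_fin, Finset.card_univ, Nat.cast_mul]
    -- Each dimension is covered by at most twice its quotient by `h` blocks. The `8` counts the
    -- block products; the `2` counts the additions, at most `2 * b / h` for each of the `a * d`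
    -- entries.
    calc _ ≤ (2 * (a / h : ℝ)) * ((2 * (b / h)) * (2 * (d / h))) * (c * (h : ℝ) ^ ω) +
          a * d * (2 * (b / h)) := by gcongr
      _ = 8 * c * (a * b * d * (h : ℝ) ^ (ω - 3)) + 2 * (a * b * d * (1 / h)) := by
          rw [hpow]
          field_simp
          ring
      _ ≤ 8 * c * (a * b * d * (h : ℝ) ^ (ω - 3)) + 2 * (a * b * d * (h : ℝ) ^ (ω - 3)) := by
          gcongr
      _ = _ := by ring

end MatMulIn

/-! ### The left triangular part of a product of matrices with small supports -/

theorem Computes.iterate {Ω K ι : Type*} [Field K] {F : Set (Ω → K)} {q : ℕ → ι → Ω → K} {y : ℝ}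
    {N : ℕ} (h0 : ∀ i, q 0 i ∈ avail F)
    (hs : ∀ k < N, Computes (F ∪ Set.range (q k)) y (Set.range (q (k + 1)))) :
    Computes F (N * y) {f | ∃ k ≤ N, ∃ i, q k i = f} := by
  induction N with
  | zero =>
    refine (Computes.of_subset ?_).mono_cost (by simp)
    rintro _ ⟨k, hk, i, rfl⟩
    rw [Nat.le_zero.1 hk]
    exact h0 i
  | succ N ih =>
    have h := (ih fun k hk => hs k (hk.trans N.lt_succ_self)).trans
      ((hs N N.lt_succ_self).mono_left (F' := F ∪ {f | ∃ k ≤ N, ∃ i, q k i = f}) ?_)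
    · refine (h.mono_right ?_).mono_cost (by push_cast; linarith)
      rintro _ ⟨k, hk, i, rfl⟩
      rcases Nat.le_succ_iff.1 hk with hk | rfl
      · exact subset_avail (Or.inl ⟨k, hk, i, rfl⟩)
      · exact subset_avail (Or.inr ⟨i, rfl⟩)
    · refine Set.Subset.trans (Set.union_subset_union_right _ ?_) subset_avail
      rintro _ ⟨i, rfl⟩
      exact ⟨N, le_rfl, i, rfl⟩

/-- The column indices are cut into `N` chunks of size at most `h`, the `k`-th one being
`{j | g j = k}`, and the row indices into their mirror images. In the `k`-th chunks the columns of
`E` are supported in `V k` and the rows of `C` in `U k`, of at most `w` elements. -/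
theorem MatMulIn.leftProduct {Ω K : Type*} [Field K] {ω c : ℝ} {F : Set (Ω → K)}
    (hM : MatMulIn K ω c) (hω : 2 ≤ ω) {n r t h w N : ℕ}
    (hh : 1 ≤ h) (hw : h ≤ w) (ht : h ≤ t)
    {C : Matrix (Fin n) (Fin r) (Ω → K)} {E : Matrix (Fin r) (Fin n) (Ω → K)}
    {B : Matrix (Fin n) (Fin t) (Ω → K)}
    (hC : vals C ⊆ avail F) (hE : vals E ⊆ avail F) (hB : vals B ⊆ avail F)
    {g : Fin n → ℕ} (hg : Monotone g) (hgN : ∀ j, g j < N)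
    (hgh : ∀ k, Fintype.card {j // g j = k} ≤ h)
    {U V : ℕ → Finset (Fin r)} (hU : ∀ k, (U k).card ≤ w) (hV : ∀ k, (V k).card ≤ w)
    (hCU : ∀ i p, p ∉ U (g i.rev) → C i p = 0) (hEV : ∀ j p, p ∉ V (g j) → E p j = 0) :
    Computes F (N * ((8 * c + 2) * ((2 * (w * h * t) + w * h * h + h * h * t) *
        (h : ℝ) ^ (ω - 3)) + w * t) + n * t)
      (vals ((Matrix.of fun i j : Fin n => if i.val + j.val + 2 ≤ n then (C * E) i j else 0) * B)) := by
  classical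
  have hUw : ∀ k, Fintype.card (U k) ≤ w := fun k => by simpa using hU k
  have hVw : ∀ k, Fintype.card (V k) ≤ w := fun k => by simpa using hV k
  have hT : Fintype.card (Fin t) ≤ t := by simp
  let Z : (k : ℕ) → Matrix (V k) (Fin t) (Ω → K) := fun k =>
    E.submatrix Subtype.val (Subtype.val : {j // g j = k} → Fin n) * B.submatrix Subtype.val id
  -- Prefix sums: the part of `E * B` coming from the chunks before `k`.
  let Q : ℕ → Matrix (Fin r) (Fin t) (Ω → K) := fun k =>
    Matrix.of fun p e => ∑ j with g j < k, E p j * B j e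
  let Ck : (k : ℕ) → Matrix {j // g j = k} (U k) (Ω → K) := fun k =>
    C.submatrix (fun j => j.val.rev) Subtype.val
  let Y : (k : ℕ) → Matrix {j // g j = k} (Fin t) (Ω → K) := fun k =>
    Ck k * (Q k).submatrix Subtype.val id
  let G : (k : ℕ) → Matrix {j // g j = k} {j // g j = k} (Ω → K) := fun k =>
    Ck k * E.submatrix Subtype.val Subtype.val
  -- Index `i` of a chunk stands for the row `i.rev`, in which the entry in column `j` lies in the
  -- left part exactly when `j < i`.
  let L : (k : ℕ) → Matrix {j // g j = k} {j // g j = k} (Ω → K) := fun k =>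
    Matrix.of fun i j => if j.val < i.val then G k i j else 0
  let O : (k : ℕ) → Matrix {j // g j = k} (Fin t) (Ω → K) := fun k =>
    L k * B.submatrix Subtype.val id
  have sub : ∀ {F' : Set (Ω → K)}, F ⊆ F' → ∀ k, vals (Ck k) ⊆ avail F' := fun hF k =>
    vals_subset_iff.2 fun i j => avail_mono hF (hC (mem_vals C _ _))
  have subB : ∀ {F' : Set (Ω → K)}, F ⊆ F' → ∀ k, vals (B.submatrix
      (Subtype.val : {j // g j = k} → Fin n) id) ⊆ avail F' := fun hF k =>
    vals_subset_iff.2 fun i j => avail_mono hF (hB (mem_vals B _ _))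
  have hZ : Computes F (N * ((8 * c + 2) * (w * h * t * (h : ℝ) ^ (ω - 3))))
      (⋃ k : Fin N, vals (Z k)) := by
    refine (Computes.iUnion fun k : Fin N => hM.rect hω hh hw le_rfl ht (hVw k) (hgh k) hT
      (vals_subset_iff.2 fun p j => hE (mem_vals E _ _)) (subB subset_rfl k)).mono_cost (by simp)
  -- From `Q k` to `Q (k + 1)` only the rows in `V k` change: `w * t` additions, although `Q` has
  -- `r` rows.
  have hQ : Computes (F ∪ ⋃ k : Fin N, vals (Z k)) (N * (w * t : ℝ))
      {f | ∃ k ≤ N, ∃ q : Fin r × Fin t, Q k q.1 q.2 = f} := by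
    refine Computes.iterate (q := fun k (q : Fin r × Fin t) => Q k q.1 q.2)
      (fun q => ?_) fun k hk => ?_
    · simpa [Q] using zero_mem_avail
    · have hs := Computes.scatter_add
        (F := (F ∪ ⋃ k : Fin N, vals (Z k)) ∪ Set.range fun q : Fin r × Fin t => Q k q.1 q.2)
        (Finset.univ : Finset (V k × Fin t)) (fun a => (a.1.1, a.2))
        (g := fun q => Q k q.1 q.2) (z := fun a => Z k a.1 a.2)
        (fun q => subset_avail (Or.inr ⟨q, rfl⟩)) (fun a _ => subset_avail (Or.inl (Or.inr
          (Set.mem_iUnion.2 ⟨⟨k, hk⟩, mem_vals _ _ _⟩))))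
      refine (hs.mono_right ?_).mono_cost ?_
      · rintro _ ⟨⟨p, e⟩, rfl⟩
        refine subset_avail ⟨(p, e), ?_⟩
        have hZk : ∀ a : V k × Fin t, Z k a.1 a.2 = ∑ j with g j = k, E a.1 j * B j a.2 :=
          fun a => Matrix.mul_apply.trans (Finset.sum_subtype {j | g j = k} (fun j => by simp)
            fun j => E a.1 j * B j a.2).symm
        have hsplit : Q (k + 1) p e = Q k p e + ∑ j with g j = k, E p j * B j e := by
          simp only [Q, Matrix.of_apply, Finset.sum_filter, ← Finset.sum_add_distrib]
          refine Finset.sum_congr rfl fun j _ => ?_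
          rcases lt_trichotomy (g j) k with hj | hj | hj
          · simp [hj, hj.ne, hj.trans k.lt_succ_self]
          · simp [hj]
          · simp [hj.not_gt, hj.ne', hj.not_ge]
        simp only [hsplit, hZk]
        congr 1
        by_cases hp : p ∈ V k
        · rw [Finset.sum_eq_single (⟨p, hp⟩, e)]
          · rintro ⟨⟨p', hp'⟩, e'⟩ ha hne
            simp only [Finset.mem_filter, Finset.mem_univ, true_and, Prod.mk.injEq] at ha
            obtain ⟨rfl, rfl⟩ := ha
            exact absurd rfl hne
          · simp
        · rw [Finset.filter_false_of_mem, Finset.sum_empty]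
          · refine (Finset.sum_eq_zero fun j hj => ?_).symm
            rw [hEV j p (by rwa [(Finset.mem_filter.1 hj).2]), zero_mul]
          · rintro ⟨⟨p', hp'⟩, e'⟩ - ha
            exact hp ((Prod.mk.inj ha).1 ▸ hp')
      · simp only [Finset.card_univ, Fintype.card_prod, Fintype.card_coe, Fintype.card_fin,
          Nat.cast_mul]
        have : ((V k).card : ℝ) ≤ w := by exact_mod_cast hV k
        gcongr
  have hY : Computes (F ∪ {f | ∃ k ≤ N, ∃ q : Fin r × Fin t, Q k q.1 q.2 = f})
      (N * ((8 * c + 2) * (h * w * t * (h : ℝ) ^ (ω - 3)))) (⋃ k : Fin N, vals (Y k)) := by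
    have hQm : ∀ (k : Fin N) (p : U k) e,
        Q k p e ∈ {f | ∃ k ≤ N, ∃ q : Fin r × Fin t, Q k q.1 q.2 = f} :=
      fun k p e => ⟨k, k.2.le, (p, e), rfl⟩
    refine (Computes.iUnion fun k : Fin N => hM.rect hω hh le_rfl hw ht (hgh k) (hUw k) hT
      (B := (Q k).submatrix Subtype.val id) (sub Set.subset_union_left k)
      (vals_subset_iff.2 fun p e => subset_avail (Or.inr (hQm k p e)))).mono_cost (by simp)
  have hG : Computes F (N * ((8 * c + 2) * (h * w * h * (h : ℝ) ^ (ω - 3))))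
      (⋃ k : Fin N, vals (G k)) := by
    refine (Computes.iUnion fun k : Fin N => hM.rect hω hh le_rfl hw le_rfl (hgh k) (hUw k) (hgh k)
      (B := E.submatrix Subtype.val Subtype.val) (sub subset_rfl k)
      (vals_subset_iff.2 fun p j => hE (mem_vals E _ _))).mono_cost (by simp)
  have hO : Computes (F ∪ ⋃ k : Fin N, vals (G k))
      (N * ((8 * c + 2) * (h * h * t * (h : ℝ) ^ (ω - 3)))) (⋃ k : Fin N, vals (O k)) := by
    refine (Computes.iUnion fun k : Fin N => hM.rect hω hh le_rfl le_rfl ht (hgh k) (hgh k) hT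
      (vals_subset_iff.2 fun i j => ?_) (subB Set.subset_union_left k)).mono_cost (by simp)
    simp only [L, Matrix.of_apply]
    split_ifs
    · exact subset_avail (Or.inr (Set.mem_iUnion.2 ⟨k, mem_vals _ _ _⟩))
    · exact zero_mem_avail
  have hS : Computes ((⋃ k : Fin N, vals (Y k)) ∪ ⋃ k : Fin N, vals (O k)) (n * t)
      (Set.range fun q : Fin n × Fin t => Y (g q.1) ⟨q.1, rfl⟩ q.2 + O (g q.1) ⟨q.1, rfl⟩ q.2) := by
    have hYm : ∀ q : Fin n × Fin t, Y (g q.1) ⟨q.1, rfl⟩ q.2 ∈ ⋃ k : Fin N, vals (Y k) := fun q =>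
      Set.mem_iUnion.2 ⟨⟨g q.1, hgN _⟩, mem_vals (Y (g q.1)) _ _⟩
    have hOm : ∀ q : Fin n × Fin t, O (g q.1) ⟨q.1, rfl⟩ q.2 ∈ ⋃ k : Fin N, vals (O k) := fun q =>
      Set.mem_iUnion.2 ⟨⟨g q.1, hgN _⟩, mem_vals (O (g q.1)) _ _⟩
    exact (Computes.range fun q => Computes.add (subset_avail (Or.inl (hYm q)))
      (subset_avail (Or.inr (hOm q)))).mono_cost (by simp)
  have hYO := ((hZ.trans' hQ).trans' (hY.mono_left subset_avail)).union (hG.trans' hO)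
  refine ((hYO.trans' (hS.mono_left (Set.subset_union_right.trans subset_avail))).mono_right
    ?_).mono_cost (le_of_eq (by ring))
  refine vals_subset_iff.2 fun i e => subset_avail ⟨(i.rev, e), ?_⟩
  have hCU' : ∀ (i' : Fin n) (x : Fin r → Ω → K),
      ∑ p : U (g i'), C i'.rev p * x p = ∑ p, C i'.rev p * x p := fun i' x => by
    rw [Finset.sum_coe_sort (U (g i')) fun p => C i'.rev p * x p]
    refine Finset.sum_subset (Finset.subset_univ _) fun p _ hp => ?_
    rw [hCU _ p (by rwa [Fin.rev_rev]), zero_mul]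
  have hYe : Y (g i.rev) ⟨i.rev, rfl⟩ e = ∑ j with g j < g i.rev, (C * E) i j * B j e := by
    refine Matrix.mul_apply.trans ?_
    refine (hCU' i.rev fun p => ∑ j with g j < g i.rev, E p j * B j e).trans ?_
    simp only [Fin.rev_rev, Matrix.mul_apply, Finset.mul_sum, Finset.sum_mul, mul_assoc]
    exact Finset.sum_comm
  have hOe : O (g i.rev) ⟨i.rev, rfl⟩ e =
      ∑ j with g j = g i.rev, (if j < i.rev then (C * E) i j else 0) * B j e := by
    have hGe : ∀ j : {j // g j = g i.rev}, G (g i.rev) ⟨i.rev, rfl⟩ j = (C * E) i j := fun j => by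
      refine Matrix.mul_apply.trans ((hCU' i.rev fun p => E p j).trans ?_)
      rw [Fin.rev_rev, Matrix.mul_apply]
    refine Matrix.mul_apply.trans ?_
    simp only [L, Matrix.of_apply, hGe]
    exact (Finset.sum_subtype {j | g j = g i.rev} (fun j => by simp) fun j =>
      (if j < i.rev then (C * E) i j else 0) * B j e).symm
  simp only [hYe, hOe]
  rw [Matrix.mul_apply, Finset.sum_filter, Finset.sum_filter, ← Finset.sum_add_distrib]
  refine Finset.sum_congr rfl fun j _ => ?_
  have hij : i.val + j.val + 2 ≤ n ↔ j < i.rev := by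
    rw [Fin.lt_def, Fin.val_rev]
    omega
  simp only [Matrix.of_apply, hij]
  -- As `g` is monotone, an earlier chunk lies wholly in the left part and a later one wholly
  -- outside; only the chunk of `i.rev` itself is cut.
  rcases lt_trichotomy (g j) (g i.rev) with hj | hj | hj
  · simp [hj, hj.ne, hg.reflect_lt hj]
  · simp [hj]
  · simp [hj.not_gt, hj.ne', (hg.reflect_lt hj).not_gt]

/-! ### The echelon factors of a Compact Bruhat representation -/

/-- The column indices in the slice `a`. -/
def slice (r s a : ℕ) : Finset (Fin r) := {k | k.val / s = a}

theorem mem_slice {r s a : ℕ} {k : Fin r} : k ∈ slice r s a ↔ k.val / s = a := by simp [slice]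

/-- Numbers with the same quotient by `s` are told apart by their remainders. This bounds both
slices and chunks. -/
theorem card_fiber_div_le {r s : ℕ} (hs : 1 ≤ s) {α : Type*} [Fintype α] (f : α → Fin r)
    (hf : Function.Injective f) (hfs : ∀ x y, (f x).val / s = (f y).val / s) :
    Fintype.card α ≤ s := by
  have : Function.Injective fun x => (⟨(f x).val % s, Nat.mod_lt _ hs⟩ : Fin s) := fun x y hxy => by
    refine hf (Fin.ext ?_)
    have h1 := Nat.div_add_mod (f x).val s
    have h2 := Nat.div_add_mod (f y).val s
    have h3 : (f x).val % s = (f y).val % s := congrArg Fin.val hxy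
    rw [hfs x y, h3] at h1
    exact h1.symm.trans h2
  simpa using Fintype.card_le_of_injective _ this

theorem card_slice_le {r s : ℕ} (hs : 1 ≤ s) (a : ℕ) : (slice r s a).card ≤ min s r := by
  refine le_min ?_ (by simpa using Finset.card_le_univ (slice r s a))
  have := card_fiber_div_le hs (fun x : slice r s a => x.val) Subtype.val_injective fun x y =>
    (mem_slice.1 x.2).trans (mem_slice.1 y.2).symm
  simpa using this

namespace BidiagShape

variable {n r s : ℕ} (β : BidiagShape n r s)

theorem rowBlock_le (hs : 1 ≤ s) (i : Fin n) : β.rowBlock i ≤ r / s := by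
  rcases β.rowBlock_bound i with h | h
  · simp [h]
  · exact (Nat.le_div_iff_mul_le hs).2 h.le

/-- The matrix `D + S * T`. -/
def echelonMatrix {R : Type*} [AddCommMonoid R] (D S : Matrix (Fin n) (Fin r) R) :
    Matrix (Fin n) (Fin r) R :=
  Matrix.of fun i p => D i p + ∑ k with β.fold k = p, S i k

/-- Row `k` of `T` has its only `1` in column `fold k`, so `S * T` sums columns of `S` and needs no
multiplication. In the form `echelonMatrix` it also makes sense over the ring `Ω → K`, which need
not be a field. -/
theorem add_mul_T {K : Type*} [Field K] (D S : Matrix (Fin n) (Fin r) K) :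
    D + S * β.T K = β.echelonMatrix D S := by
  ext i p
  simp [echelonMatrix, Matrix.mul_apply, T, Finset.sum_filter, eq_comm]

/-- The columns where the rows of the block `a` of `D + S * T` can be nonzero. -/
def support (a : ℕ) : Finset (Fin r) :=
  slice r s a ∪ (if a = 0 then ∅ else slice r s (a - 1)).image β.fold

theorem card_support_le (hs : 1 ≤ s) (a : ℕ) : (β.support a).card ≤ 2 * min s r := by
  refine (Finset.card_union_le _ _).trans ?_
  rw [two_mul]
  refine Nat.add_le_add (card_slice_le hs a) (Finset.card_image_le.trans ?_)
  split_ifs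
  · simp
  · exact card_slice_le hs _

variable {Ω K : Type*} [Field K] {D S : Matrix (Fin n) (Fin r) (Ω → K)}

theorem echelonMatrix_eq_zero (hD : ∀ i j, β.rowBlock i ≠ j.val / s → D i j = 0)
    (hS : ∀ i j, β.rowBlock i ≠ j.val / s + 1 → S i j = 0) {i : Fin n} {p : Fin r}
    (hp : p ∉ β.support (β.rowBlock i)) : β.echelonMatrix D S i p = 0 := by
  simp only [support, Finset.mem_union, mem_slice, Finset.mem_image, not_or, not_exists,
    not_and] at hp
  simp only [echelonMatrix, Matrix.of_apply]
  rw [hD i p fun h => hp.1 h.symm, zero_add]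
  refine Finset.sum_eq_zero fun k hk => hS i k fun h => hp.2 k ?_ (Finset.mem_filter.1 hk).2
  simp [h, mem_slice]

/-- One addition for each position where `S` may be nonzero; in row `i` these lie in the single
slice `rowBlock i - 1`, and there are none when `rowBlock i = 0`. -/
theorem computes_echelonMatrix {F : Set (Ω → K)} (hs : 1 ≤ s)
    (hS : ∀ i j, β.rowBlock i ≠ j.val / s + 1 → S i j = 0)
    (hDF : vals D ⊆ avail F) (hSF : vals S ⊆ avail F) :
    Computes F (n * min s r : ℕ) (vals (β.echelonMatrix D S)) := by
  classical
  let P : Finset (Fin n × Fin r) := {q | β.rowBlock q.1 = q.2.val / s + 1}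
  have h := Computes.scatter_add (F := F) P (fun q => (q.1, β.fold q.2))
    (g := fun q => D q.1 q.2) (z := fun q => S q.1 q.2) (fun q => hDF (mem_vals D _ _))
    (fun q _ => hSF (mem_vals S _ _))
  refine (h.mono_right (vals_subset_iff.2 fun i p => subset_avail ⟨(i, p), ?_⟩)).mono_cost ?_
  · simp only [echelonMatrix, Matrix.of_apply, P]
    congr 1
    rw [Finset.filter_filter, Finset.sum_filter, Finset.sum_filter, ← Finset.univ_product_univ,
      Finset.sum_product, Finset.sum_eq_single i]
    · refine Finset.sum_congr rfl fun k _ => ?_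
      by_cases hk : β.rowBlock i = k.val / s + 1
      · simp [hk]
      · simp [hk, hS i k hk]
    · intro i' _ hi'
      simp [hi']
    · simp
  · norm_cast
    have : P ⊆ Finset.univ.biUnion fun i : Fin n =>
        ({i} : Finset (Fin n)) ×ˢ slice r s (β.rowBlock i - 1) := fun q hq => by
      have hq' : β.rowBlock q.1 = q.2.val / s + 1 := by simpa [P] using hq
      exact Finset.mem_biUnion.2 ⟨q.1, Finset.mem_univ _, Finset.mem_product.2
        ⟨Finset.mem_singleton_self _, mem_slice.2 (by rw [hq', Nat.add_sub_cancel])⟩⟩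
    refine (Finset.card_le_card this).trans (Finset.card_biUnion_le.trans ?_)
    refine (Finset.sum_le_sum fun i _ => ?_).trans (b := ∑ _i : Fin n, min s r) (by simp)
    simpa [Finset.card_product] using card_slice_le hs _

end BidiagShape

theorem IsColumnEchelon.le {K : Type*} [Field K] {n r : ℕ} {C : Matrix (Fin n) (Fin r) K}
    (h : IsColumnEchelon C) : r ≤ n := by
  obtain ⟨p, hp, -⟩ := h
  simpa using Fintype.card_le_of_injective p hp.injective

/-! ### Products with a left triangular matrix -/

/-- The leading term of the cost of a product with a dense `n × t` matrix. -/
noncomputable def productCost (ω : ℝ) (n s t : ℕ) : ℝ :=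
  n * (max (min s n) t : ℕ) * ((min (min s n) t : ℕ) : ℝ) ^ (ω - 2)

theorem productCost_nonneg (ω : ℝ) (n s t : ℕ) : 0 ≤ productCost ω n s t := by
  unfold productCost
  positivity

/-- The index data of `CBShape` determine a cutting of the columns, and by symmetry of the rows,
into chunks. -/
def CBShape.chunk {n s : ℕ} (σ : CBShape n s) (h : ℕ) (j : Fin n) : ℕ :=
  j.val / h + σ.row.rowBlock j + (σ.r / s - σ.col.rowBlock j.rev)

namespace CBShape

variable {n s : ℕ} (σ : CBShape n s) (h : ℕ)

theorem chunk_monotone : Monotone (σ.chunk h) := fun i j hij => by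
  have h1 := σ.row.rowBlock_mono hij
  have h2 := σ.col.rowBlock_mono (Fin.rev_le_rev.2 hij)
  have h3 : i.val / h ≤ j.val / h := Nat.div_le_div_right hij
  unfold chunk
  omega

/-- A sum of nondecreasing functions takes equal values only where every summand does, so `chunk` is
the common refinement of three cuttings, with few values. The bound `rowBlock_le` keeps the natural
subtraction in `chunk` exact. -/
theorem eq_of_chunk_eq (hs : 1 ≤ s) {i j : Fin n} (hij : σ.chunk h i = σ.chunk h j) :
    i.val / h = j.val / h ∧ σ.row.rowBlock i = σ.row.rowBlock j ∧
      σ.col.rowBlock i.rev = σ.col.rowBlock j.rev := by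
  wlog hle : i ≤ j generalizing i j
  · obtain ⟨h1, h2, h3⟩ := this hij.symm (le_of_not_ge hle)
    exact ⟨h1.symm, h2.symm, h3.symm⟩
  have h1 := σ.row.rowBlock_mono hle
  have h2 := σ.col.rowBlock_mono (Fin.rev_le_rev.2 hle)
  have h3 : i.val / h ≤ j.val / h := Nat.div_le_div_right hle
  have h4 := σ.col.rowBlock_le hs i.rev
  unfold chunk at hij
  omega

theorem chunk_lt (hs : 1 ≤ s) (j : Fin n) : σ.chunk h j < n / h + 2 * (σ.r / s) + 1 := by
  have h1 := σ.row.rowBlock_le hs j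
  have h3 : j.val / h ≤ n / h := Nat.div_le_div_right j.2.le
  unfold chunk
  omega

end CBShape

/-- There are at most `4 * n / h` chunks, since `r / s ≤ n / h` and `1 ≤ n / h`. The three kinds of
products contribute `28 * (8 * c + 2)`, the prefix sums `8`, the final additions `1`, and forming
`C` and `E` contributes `2`; the lower order terms are absorbed by `h * h ^ (ω - 3) ≥ 1`. -/
theorem leftProduct_cost_le {ω c : ℝ} (hω : 2 ≤ ω) (hc : 0 ≤ c) {n s t r h s' : ℕ} (hn : 1 ≤ n)
    (hs : 1 ≤ s) (ht : 1 ≤ t) (hr : r ≤ n) (hs' : s' = min s n) (hh : h = min s' t) :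
    ((n / h + 2 * (r / s) + 1 : ℕ) : ℝ) * ((8 * c + 2) * ((2 * ((2 * s' : ℕ) * h * t) +
      (2 * s' : ℕ) * h * h + h * h * t) * (h : ℝ) ^ (ω - 3)) + (2 * s' : ℕ) * t) + n * t +
      (2 * (n * s') : ℕ) ≤ (224 * c + 67) * productCost ω n s t := by
  have h1 : 1 ≤ h := by omega
  have hhs' : h ≤ s' := by omega
  have hht : h ≤ t := by omega
  have h0 : (0 : ℝ) < h := by exact_mod_cast h1
  have h1r : (1 : ℝ) ≤ h := by exact_mod_cast h1
  have hsr : (h : ℝ) ≤ s' := by exact_mod_cast hhs'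
  have htr : (h : ℝ) ≤ t := by exact_mod_cast hht
  have hN : ((n / h + 2 * (r / s) + 1 : ℕ) : ℝ) ≤ 4 * (n / h) := by
    have e1 : r / s ≤ n / h := (Nat.div_le_div_right hr).trans (Nat.div_le_div_left (by omega) h1)
    have e2 : 1 ≤ n / h := (Nat.one_le_div_iff h1).2 (by omega)
    have e3 : n / h + 2 * (r / s) + 1 ≤ 4 * (n / h) := by omega
    have e4 : ((n / h : ℕ) : ℝ) ≤ n / h := Nat.cast_div_le
    have e5 : ((n / h + 2 * (r / s) + 1 : ℕ) : ℝ) ≤ 4 * (n / h : ℕ) := by exact_mod_cast e3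
    linarith
  set q : ℝ := (h : ℝ) ^ (ω - 3) with hq
  have hinv : (1 : ℝ) / h ≤ q := by
    rw [one_div, ← Real.rpow_neg_one]
    exact Real.rpow_le_rpow_of_exponent_le h1r (by linarith)
  have hq0 : 0 ≤ q := by positivity
  have hhq : 1 ≤ h * q := by rwa [div_le_iff₀' h0] at hinv
  have hcost : productCost ω n s t = n * s' * t * q := by
    have e1 : ((max s' t : ℕ) : ℝ) * (h : ℕ) = s' * t := by
      rw [hh]; exact_mod_cast max_mul_min s' t
    have e2 : (h : ℝ) ^ (ω - 2) = h * q := by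
      rw [show ω - 2 = 1 + (ω - 3) by ring, Real.rpow_add h0, Real.rpow_one]
    rw [productCost, ← hs', ← hh, e2]
    linear_combination (n : ℝ) * q * e1
  have hsq : 1 ≤ s' * q := hhq.trans (by gcongr)
  have htq : 1 ≤ t * q := hhq.trans (by gcongr)
  rw [hcost]
  push_cast
  have b1 : (2 * (2 * s' * h * t) + 2 * s' * h * h + h * h * t : ℝ) ≤ 7 * (s' * h * t) := by
    have : (s' * h * h : ℝ) ≤ s' * h * t := by gcongr
    have : (h * h * t : ℝ) ≤ s' * h * t := by gcongr
    linarith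
  have b2 : (n * t : ℝ) ≤ n * s' * t * q := by
    calc (n * t : ℝ) = n * t * 1 := by ring
      _ ≤ n * t * (s' * q) := by gcongr
      _ = _ := by ring
  have b3 : (n * s' : ℝ) ≤ n * s' * t * q := by
    calc (n * s' : ℝ) = n * s' * 1 := by ring
      _ ≤ n * s' * (t * q) := by gcongr
      _ = _ := by ring
  push_cast at hN
  calc _ ≤ 4 * (n / h : ℝ) * ((8 * c + 2) * (7 * (s' * h * t) * q) + 2 * s' * t) + n * t +
        2 * (n * s') := by gcongr
    _ = 28 * (8 * c + 2) * (n * s' * t * q) + 8 * (n * s' * t * (1 / h)) + n * t +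
        2 * (n * s') := by
        field_simp
        ring
    _ ≤ 28 * (8 * c + 2) * (n * s' * t * q) + 8 * (n * s' * t * q) + n * s' * t * q +
        2 * (n * s' * t * q) := by gcongr
    _ = _ := by ring

theorem MatMulIn.leftCompactBruhat_mul {Ω K : Type*} [Field K] {ω c : ℝ} {F : Set (Ω → K)}
    (hM : MatMulIn K ω c) (hω : 2 ≤ ω) {n s t : ℕ} (hs : 1 ≤ s) (σ : CBShape n s)
    {X : Ω → CBEntry σ → K} {A : Matrix (Fin n) (Fin n) (Ω → K)} {B : Matrix (Fin n) (Fin t) (Ω → K)}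
    (hA : ∀ o, IsLeftCompactBruhat σ (X o) (A.map fun f => f o))
    (hX : ∀ e, (fun o => X o e) ∈ avail F) (hB : vals B ⊆ avail F) :
    Computes F ((224 * c + 67) * productCost ω n s t) (vals (A * B)) := by
  have hc := hM.nonneg
  have hpos : 0 ≤ (224 * c + 67) * productCost ω n s t :=
    mul_nonneg (by linarith) (productCost_nonneg _ _ _ _)
  rcases isEmpty_or_nonempty Ω with hΩ | ⟨⟨o₀⟩⟩
  · exact .of_isEmpty hpos
  rcases Nat.eq_zero_or_pos n with rfl | hn
  · exact .done hpos (vals_subset_iff.2 fun i => i.elim0)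
  rcases Nat.eq_zero_or_pos t with rfl | ht
  · exact .done hpos (vals_subset_iff.2 fun _ j => j.elim0)
  have hr : σ.r ≤ n := (hA o₀).echelon_C.le
  obtain ⟨s', hs'⟩ : ∃ s', s' = min s n := ⟨_, rfl⟩
  obtain ⟨h, hh⟩ : ∃ h, h = min s' t := ⟨_, rfl⟩
  have hrs' : min s σ.r ≤ s' := by omega
  let DC : Matrix (Fin n) (Fin σ.r) (Ω → K) := Matrix.of fun i j o => X o (.DC i j)
  let SC : Matrix (Fin n) (Fin σ.r) (Ω → K) := Matrix.of fun i j o => X o (.SC i j)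
  let DE : Matrix (Fin n) (Fin σ.r) (Ω → K) := Matrix.of fun j i o => X o (.DE i j)
  let SE : Matrix (Fin n) (Fin σ.r) (Ω → K) := Matrix.of fun j i o => X o (.SE i j)
  -- The entries outside the prescribed blocks vanish for every admissible input, so they are the
  -- zero function.
  have hDC : ∀ i j, σ.col.rowBlock i ≠ j.val / s → DC i j = 0 := fun i j hij =>
    funext fun o => not_not.1 fun hne => hij ((hA o).blockDiag_C i j hne)
  have hSC : ∀ i j, σ.col.rowBlock i ≠ j.val / s + 1 → SC i j = 0 := fun i j hij =>
    funext fun o => not_not.1 fun hne => hij ((hA o).blockSubdiag_C i j hne)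
  have hDE : ∀ i j, σ.row.rowBlock i ≠ j.val / s → DE i j = 0 := fun i j hij =>
    funext fun o => not_not.1 fun hne => hij ((hA o).blockDiag_E i j hne)
  have hSE : ∀ i j, σ.row.rowBlock i ≠ j.val / s + 1 → SE i j = 0 := fun i j hij =>
    funext fun o => not_not.1 fun hne => hij ((hA o).blockSubdiag_E i j hne)
  let C := σ.col.echelonMatrix DC SC
  let Et := σ.row.echelonMatrix DE SE
  -- This is the product of `R` with the echelon factor: a relabelling of rows, free of charge.
  let E : Matrix (Fin σ.r) (Fin n) (Ω → K) := Matrix.of fun p j => Et j (σ.perm p)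
  have hCE : Computes F (2 * (n * s') : ℕ) (vals C ∪ vals Et) := by
    refine ((σ.col.computes_echelonMatrix hs hSC (vals_subset_iff.2 fun i j => hX _)
      (vals_subset_iff.2 fun i j => hX _)).union (σ.row.computes_echelonMatrix hs hSE
      (vals_subset_iff.2 fun i j => hX _) (vals_subset_iff.2 fun i j => hX _))).mono_cost ?_
    rw [two_mul]
    norm_cast
    gcongr
  -- All members of a chunk share their row blocks, so the supports are functions of the chunk
  -- number. Numbers of empty chunks get block `0`, where only the cardinality bound matters.
  let U : ℕ → Finset (Fin σ.r) := fun k => σ.col.support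
    (Function.extend (σ.chunk h) (fun j => σ.col.rowBlock j.rev) 0 k)
  let V : ℕ → Finset (Fin σ.r) := fun k => (σ.row.support
    (Function.extend (σ.chunk h) σ.row.rowBlock 0 k)).map σ.perm.symm.toEmbedding
  have hU : ∀ j, U (σ.chunk h j) = σ.col.support (σ.col.rowBlock j.rev) := fun j => by
    have : Function.FactorsThrough (fun j : Fin n => σ.col.rowBlock j.rev) (σ.chunk h) :=
      fun i j hij => (σ.eq_of_chunk_eq h hs hij).2.2
    simp only [U, this.extend_apply]
  have hV : ∀ j, V (σ.chunk h j) = (σ.row.support (σ.row.rowBlock j)).map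
      σ.perm.symm.toEmbedding := fun j => by
    have : Function.FactorsThrough σ.row.rowBlock (σ.chunk h) :=
      fun i j hij => (σ.eq_of_chunk_eq h hs hij).2.1
    simp only [V, this.extend_apply]
  have hprod := hM.leftProduct (F := F ∪ (vals C ∪ vals Et)) hω (h := h) (w := 2 * s') (by omega)
    (by omega) (by omega) (C := C) (E := E) (B := B)
    (Set.Subset.trans (fun f hf => Or.inr (Or.inl hf)) subset_avail)
    (vals_subset_iff.2 fun p j => subset_avail (Or.inr (Or.inr (mem_vals Et _ _))))
    (hB.trans (avail_mono Set.subset_union_left)) (σ.chunk_monotone h) (σ.chunk_lt h hs)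
    (fun k => card_fiber_div_le (by omega) Subtype.val Subtype.val_injective fun x y =>
      (σ.eq_of_chunk_eq h hs (x.2.trans y.2.symm)).1) (U := U) (V := V)
    (fun k => (σ.col.card_support_le hs _).trans (by omega))
    (fun k => by
      rw [Finset.card_map]
      exact (σ.row.card_support_le hs _).trans (by omega))
    (fun i p hp => σ.col.echelonMatrix_eq_zero hDC hSC (by rwa [hU, Fin.rev_rev] at hp))
    (fun j p hp => σ.row.echelonMatrix_eq_zero hDE hSE (fun hp' => hp (by
      rw [hV]
      exact Finset.mem_map.2 ⟨_, hp', by simp⟩)))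
  have hAeq : A = Matrix.of fun i j : Fin n =>
      if i.val + j.val + 2 ≤ n then (C * E) i j else 0 := by
    ext i j o
    have h1 := congrFun (congrFun (hA o).eq_leftPart i) j
    have hCo : σ.C (X o) = Matrix.of fun i j => C i j o := by
      rw [CBShape.C, BidiagShape.add_mul_T]
      ext i j
      simp [C, BidiagShape.echelonMatrix, DC, SC]
    have hEo : σ.E (X o) = (Matrix.of fun i j => Et i j o).transpose := by
      rw [← Matrix.transpose_transpose (σ.E (X o))]
      congr 1
      rw [CBShape.E, Matrix.transpose_add, Matrix.transpose_mul, Matrix.transpose_transpose,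
        BidiagShape.add_mul_T]
      ext i j
      simp [Et, BidiagShape.echelonMatrix, DE, SE]
    rw [Matrix.map_apply] at h1
    rw [h1, hCo, hEo]
    simp only [leftPart, Matrix.of_apply, Matrix.mul_assoc]
    split_ifs
    · simp [Matrix.mul_apply, Equiv.Perm.permMatrix, PEquiv.toMatrix_toPEquiv_mul, E]
    · rfl
  rw [hAeq]
  refine (hCE.trans' hprod).mono_cost ?_
  have := leftProduct_cost_le hω hc hn hs ht hr hs' hh
  linarith

/-! ### Products with a quasiseparable matrix -/

theorem mul_le_productCost {ω : ℝ} (hω : 2 ≤ ω) {n s t : ℕ} (hs : 1 ≤ s) :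
    (n * t : ℝ) ≤ productCost ω n s t := by
  rcases Nat.eq_zero_or_pos n with rfl | hn
  · simpa using productCost_nonneg ω 0 s t
  rcases Nat.eq_zero_or_pos t with rfl | ht
  · simpa using productCost_nonneg ω n s 0
  have h1 : (1 : ℝ) ≤ ((min (min s n) t : ℕ) : ℝ) := by
    exact_mod_cast (by omega : 1 ≤ min (min s n) t)
  have h2 := Real.one_le_rpow h1 (by linarith : 0 ≤ ω - 2)
  have h3 : (t : ℝ) ≤ (max (min s n) t : ℕ) := by exact_mod_cast le_max_right _ _
  calc (n * t : ℝ) = n * t * 1 := (mul_one _).symm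
    _ ≤ productCost ω n s t := by unfold productCost; gcongr

theorem productCost_le {ω : ℝ} (hω : 2 ≤ ω) {n s t a b : ℕ} (ha : max (min s n) t ≤ a)
    (hb : min (min s n) t ≤ b) : productCost ω n s t ≤ n * a * (b : ℝ) ^ (ω - 2) := by
  have : 0 ≤ ω - 2 := by linarith
  unfold productCost
  gcongr

/-- With `J` the antidiagonal flip, `M = diag M + J * Left(J * M) + Left(M * J) * J`: the two
flipped left parts are the strictly lower and strictly upper triangles of `M`. -/
theorem quasiseparable_mul_apply {R : Type*} [CommRing R] {n t : ℕ} (M : Matrix (Fin n) (Fin n) R)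
    (B : Matrix (Fin n) (Fin t) R) (i : Fin n) (e : Fin t) :
    (M * B) i e = M i i * B i e +
      ((Matrix.of fun i j : Fin n => if i.val + j.val + 2 ≤ n then M i.rev j else 0) * B) i.rev e +
      ((Matrix.of fun i j : Fin n => if i.val + j.val + 2 ≤ n then M i j.rev else 0) *
        B.submatrix Fin.rev id) i e := by
  simp only [Matrix.mul_apply, Matrix.of_apply, Fin.rev_rev, Matrix.submatrix_apply, id]
  have h0 := Equiv.sum_comp Fin.revPerm fun j : Fin n =>
    (if i.val + j.val + 2 ≤ n then M i j.rev else 0) * B j.rev e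
  rw [← h0]
  simp only [Fin.revPerm_apply, Fin.rev_rev]
  have h : M i i * B i e = ∑ j, if i = j then M i j * B j e else 0 := by simp
  rw [h, ← Finset.sum_add_distrib, ← Finset.sum_add_distrib]
  refine Finset.sum_congr rfl fun j _ => ?_
  have h1 : i.rev.val + j.val + 2 ≤ n ↔ j < i := by
    rw [Fin.lt_def, Fin.val_rev]; omega
  have h2 : i.val + j.rev.val + 2 ≤ n ↔ i < j := by
    rw [Fin.lt_def, Fin.val_rev]; omega
  simp only [h1, h2]
  rcases lt_trichotomy i j with hj | hj | hj
  · simp [hj, hj.ne, hj.not_gt]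
  · simp [hj]
  · simp [hj, hj.ne', hj.not_gt]

theorem unitAntidiag_mul_apply {K : Type*} [Field K] {n : ℕ} (M : Matrix (Fin n) (Fin n) K)
    (i j : Fin n) : (unitAntidiag n K * M) i j = M i.rev j := by
  simp [unitAntidiag, Matrix.mul_apply]

theorem mul_unitAntidiag_apply {K : Type*} [Field K] {n : ℕ} (M : Matrix (Fin n) (Fin n) K)
    (i j : Fin n) : (M * unitAntidiag n K) i j = M i j.rev := by
  have h : ∀ k : Fin n, j = k.rev ↔ k = j.rev := fun k => by rw [eq_comm, Fin.rev_eq_iff]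
  simp [unitAntidiag, Matrix.mul_apply, h]

theorem MatMulIn.compactBruhat_mul {Ω K : Type*} [Field K] {ω c : ℝ} {F : Set (Ω → K)}
    (hM : MatMulIn K ω c) (hω : 2 ≤ ω) {n s t : ℕ} (hs : 1 ≤ s) (σ : QSShape n s)
    {X : Ω → QSEntry σ → K} {M : Matrix (Fin n) (Fin n) (Ω → K)} {B : Matrix (Fin n) (Fin t) (Ω → K)}
    (hMX : ∀ o, IsCompactBruhat σ (X o) (M.map fun f => f o))
    (hX : ∀ e, (fun o => X o e) ∈ avail F) (hB : vals B ⊆ avail F) :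
    Computes F ((448 * c + 137) * productCost ω n s t) (vals (M * B)) := by
  let Lo : Matrix (Fin n) (Fin n) (Ω → K) :=
    Matrix.of fun i j => if i.val + j.val + 2 ≤ n then M i.rev j else 0
  let Up : Matrix (Fin n) (Fin n) (Ω → K) :=
    Matrix.of fun i j => if i.val + j.val + 2 ≤ n then M i j.rev else 0
  have hLo := hM.leftCompactBruhat_mul (F := F) hω hs σ.lower (X := fun o e => X o (.lower e))
    (A := Lo) (B := B) (fun o => by
      convert (hMX o).lower using 1
      ext i j
      simp only [leftPart, Matrix.of_apply, unitAntidiag_mul_apply, Matrix.map_apply, Lo]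
      split_ifs <;> rfl) (fun e => hX _) hB
  have hUp := hM.leftCompactBruhat_mul (F := F) hω hs σ.upper (X := fun o e => X o (.upper e))
    (A := Up) (B := B.submatrix Fin.rev id) (fun o => by
      convert (hMX o).upper using 1
      ext i j
      simp only [leftPart, Matrix.of_apply, mul_unitAntidiag_apply, Matrix.map_apply, Up]
      split_ifs <;> rfl) (fun e => hX _) (vals_subset_iff.2 fun i j => hB (mem_vals B _ _))
  have hdiag : ∀ i, M i i ∈ avail F := fun i => by
    have : M i i = fun o => X o (.diag i) := funext fun o => ((hMX o).diag i).symm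
    exact this ▸ hX _
  have hsum : Computes (F ∪ (vals (Lo * B) ∪ vals (Up * B.submatrix Fin.rev id))) (n * t * (1 + 1 + 1))
      (vals (M * B)) := by
    refine (Computes.range (x := 1 + 1 + 1) fun q : Fin n × Fin t => ?_).mono_cost (by simp)
    simp only [quasiseparable_mul_apply M B]
    refine ((Computes.mul (avail_mono Set.subset_union_left (hdiag q.1)) (avail_mono
      Set.subset_union_left (hB (mem_vals B q.1 q.2)))).trans' (Computes.add
        (b := (Lo * B) q.1.rev q.2) (subset_avail (Or.inr rfl))
        (subset_avail (Or.inl (Or.inr (Or.inl (mem_vals _ _ _))))))).trans' (Computes.add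
        (b := (Up * B.submatrix Fin.rev id) q.1 q.2) (subset_avail (Or.inr rfl))
        (subset_avail (Or.inl (Or.inr (Or.inr (mem_vals _ _ _))))))
  -- Two triangular products and three operations per output entry: `137 = 2 * 67 + 3`.
  refine ((hLo.union hUp).trans' hsum).mono_cost ?_
  have := mul_le_productCost hω (n := n) (t := t) hs
  linarith

theorem vals_one_subset {Ω K : Type*} [Field K] {n : ℕ} {F : Set (Ω → K)} :
    vals (1 : Matrix (Fin n) (Fin n) (Ω → K)) ⊆ avail F :=
  vals_subset_iff.2 fun i j => by
    rw [Matrix.one_apply]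
    split_ifs
    · exact const_mem_avail 1
    · exact const_mem_avail 0

theorem MatMulIn.compactBruhat_mul_compactBruhat {Ω K : Type*} [Field K] {ω c : ℝ}
    {F : Set (Ω → K)} (hM : MatMulIn K ω c) (hω : 2 ≤ ω) {n s : ℕ} (hs : 1 ≤ s) (σ τ : QSShape n s)
    {X : Ω → QSEntry σ → K} {Y : Ω → QSEntry τ → K} {M N : Matrix (Fin n) (Fin n) (Ω → K)}
    (hMX : ∀ o, IsCompactBruhat σ (X o) (M.map fun f => f o))
    (hNY : ∀ o, IsCompactBruhat τ (Y o) (N.map fun f => f o))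
    (hX : ∀ e, (fun o => X o e) ∈ avail F) (hY : ∀ e, (fun o => Y o e) ∈ avail F) :
    Computes F (2 * ((448 * c + 137) * productCost ω n s n)) (vals (M * N)) := by
  -- The dense form of `N` is `N * 1`, and the entries of the identity are free constants.
  have hN := hM.compactBruhat_mul (F := F) hω hs τ hNY hY vals_one_subset
  rw [Matrix.mul_one] at hN
  have hMN := hM.compactBruhat_mul (F := F ∪ vals N) hω hs σ hMX (B := N)
    (fun e => avail_mono Set.subset_union_left (hX e)) (Set.subset_union_right.trans subset_avail)
  rw [two_mul]
  exact hN.trans' hMN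

/-! ### The programs -/

theorem exists_slp_compactBruhat_mul {K : Type*} [Field K] {ω c : ℝ} (hM : MatMulIn K ω c)
    (hω : 2 ≤ ω) {n s : ℕ} (hs : 1 ≤ s) (σ : QSShape n s) (t : ℕ) :
    ∃ P : SLP K (QSEntry σ ⊕ (Fin n × Fin t)) (Fin n × Fin t),
      (P.size : ℝ) ≤ (448 * c + 137) * productCost ω n s t ∧
      ∀ X M, IsCompactBruhat σ X M → ∀ B : Matrix (Fin n) (Fin t) K,
        P.Outputs (Sum.elim X (entries B)) (entries (M * B)) := by
  -- The inputs are restricted to valid representations. `M` is recorded in `Ω` so that its entries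
  -- are functions of the input, but only `X` and `B` are read by the program.
  let Ω := {p : (QSEntry σ → K) × Matrix (Fin n) (Fin n) K × Matrix (Fin n) (Fin t) K //
    IsCompactBruhat σ p.1 p.2.1}
  let inp : Ω → QSEntry σ ⊕ (Fin n × Fin t) → K := fun o => Sum.elim o.1.1 (entries o.1.2.2)
  have h := hM.compactBruhat_mul (F := Set.range fun i (o : Ω) => inp o i) hω hs σ
    (X := fun o => o.1.1) (M := Matrix.of fun i j o => o.1.2.1 i j)
    (B := Matrix.of fun i j o => o.1.2.2 i j) (fun o => o.2)
    (fun e => subset_avail ⟨.inl e, rfl⟩)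
    (vals_subset_iff.2 fun i j => subset_avail ⟨.inr (i, j), rfl⟩)
  obtain ⟨P, hP, hout⟩ := h.exists_slp (inp := inp) fun f hf => hf
  refine ⟨P, hP, fun X M hXM B => ?_⟩
  convert hout ⟨(X, M, B), hXM⟩ using 1
  ext q
  simp [entries, Matrix.mul_apply, Finset.sum_apply]

theorem exists_slp_compactBruhat_mul_vec {K : Type*} [Field K] {ω c : ℝ} (hM : MatMulIn K ω c)
    (hω : 2 ≤ ω) {n s : ℕ} (hs : 1 ≤ s) (σ : QSShape n s) :
    ∃ P : SLP K (QSEntry σ ⊕ Fin n) (Fin n),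
      (P.size : ℝ) ≤ (448 * c + 137) * productCost ω n s 1 ∧
      ∀ X M, IsCompactBruhat σ X M → ∀ v : Fin n → K,
        P.Outputs (Sum.elim X v) (M.mulVec v) := by
  let Ω := {p : (QSEntry σ → K) × Matrix (Fin n) (Fin n) K × (Fin n → K) //
    IsCompactBruhat σ p.1 p.2.1}
  let inp : Ω → QSEntry σ ⊕ Fin n → K := fun o => Sum.elim o.1.1 o.1.2.2
  let M' : Matrix (Fin n) (Fin n) (Ω → K) := Matrix.of fun i j o => o.1.2.1 i j
  let B' : Matrix (Fin n) (Fin 1) (Ω → K) := Matrix.of fun i _ o => o.1.2.2 i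
  have h := hM.compactBruhat_mul (F := Set.range fun i (o : Ω) => inp o i) hω hs σ
    (X := fun o => o.1.1) (M := M') (B := B') (fun o => o.2)
    (fun e => subset_avail ⟨.inl e, rfl⟩)
    (vals_subset_iff.2 fun i j => subset_avail ⟨.inr i, rfl⟩)
  obtain ⟨P, hP, hout⟩ := (h.mono_right (H := Set.range fun i => (M' * B') i 0)
    (Set.range_subset_iff.2 fun i => subset_avail (mem_vals _ _ _))).exists_slp
      (inp := inp) fun f hf => hf
  refine ⟨P, hP, fun X M hXM v => ?_⟩
  convert hout ⟨(X, M, v), hXM⟩ using 1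
  ext i
  simp [M', B', Matrix.mulVec, dotProduct, Matrix.mul_apply, Finset.sum_apply]

theorem exists_slp_compactBruhat_mul_compactBruhat {K : Type*} [Field K] {ω c : ℝ} (hM : MatMulIn K ω c)
    (hω : 2 ≤ ω) {n s : ℕ} (hs : 1 ≤ s) (σ τ : QSShape n s) :
    ∃ P : SLP K (QSEntry σ ⊕ QSEntry τ) (Fin n × Fin n),
      (P.size : ℝ) ≤ 2 * ((448 * c + 137) * productCost ω n s n) ∧
      ∀ X M, IsCompactBruhat σ X M → ∀ Y N, IsCompactBruhat τ Y N →
        P.Outputs (Sum.elim X Y) (entries (M * N)) := by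
  let Ω := {p : ((QSEntry σ → K) × Matrix (Fin n) (Fin n) K) ×
    ((QSEntry τ → K) × Matrix (Fin n) (Fin n) K) //
      IsCompactBruhat σ p.1.1 p.1.2 ∧ IsCompactBruhat τ p.2.1 p.2.2}
  let inp : Ω → QSEntry σ ⊕ QSEntry τ → K := fun o => Sum.elim o.1.1.1 o.1.2.1
  have h := hM.compactBruhat_mul_compactBruhat (F := Set.range fun i (o : Ω) => inp o i) hω hs σ τ
    (X := fun o => o.1.1.1) (M := Matrix.of fun i j o => o.1.1.2 i j)
    (Y := fun o => o.1.2.1) (N := Matrix.of fun i j o => o.1.2.2 i j) (fun o => o.2.1)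
    (fun o => o.2.2) (fun e => subset_avail ⟨.inl e, rfl⟩) (fun e => subset_avail ⟨.inr e, rfl⟩)
  obtain ⟨P, hP, hout⟩ := h.exists_slp (inp := inp) fun f hf => hf
  refine ⟨P, hP, fun X M hXM Y N hYN => ?_⟩
  convert hout ⟨((X, M), (Y, N)), hXM, hYN⟩ using 1
  ext q
  simp [entries, Matrix.mul_apply, Finset.sum_apply]

theorem exists_slp_leftCompactBruhat_mul {K : Type*} [Field K] {ω c : ℝ} (hM : MatMulIn K ω c)
    (hω : 2 ≤ ω) {n s : ℕ} (hs : 1 ≤ s) (σ : CBShape n s) (t : ℕ) :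
    ∃ P : SLP K (CBEntry σ ⊕ (Fin n × Fin t)) (Fin n × Fin t),
      (P.size : ℝ) ≤ (224 * c + 67) * productCost ω n s t ∧
      ∀ X A, IsLeftCompactBruhat σ X A → ∀ B : Matrix (Fin n) (Fin t) K,
        P.Outputs (Sum.elim X (entries B)) (entries (A * B)) := by
  let Ω := {p : (CBEntry σ → K) × Matrix (Fin n) (Fin n) K × Matrix (Fin n) (Fin t) K //
    IsLeftCompactBruhat σ p.1 p.2.1}
  let inp : Ω → CBEntry σ ⊕ (Fin n × Fin t) → K := fun o => Sum.elim o.1.1 (entries o.1.2.2)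
  have h := hM.leftCompactBruhat_mul (F := Set.range fun i (o : Ω) => inp o i) hω hs σ
    (X := fun o => o.1.1) (A := Matrix.of fun i j o => o.1.2.1 i j)
    (B := Matrix.of fun i j o => o.1.2.2 i j) (fun o => o.2)
    (fun e => subset_avail ⟨.inl e, rfl⟩)
    (vals_subset_iff.2 fun i j => subset_avail ⟨.inr (i, j), rfl⟩)
  obtain ⟨P, hP, hout⟩ := h.exists_slp (inp := inp) fun f hf => hf
  refine ⟨P, hP, fun X M hXM B => ?_⟩
  convert hout ⟨(X, M, B), hXM⟩ using 1
  ext q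
  simp [entries, Matrix.mul_apply, Finset.sum_apply]


theorem mainTheorem4 (ω c : ℝ) (hω2 : 2 ≤ ω) (hω3 : ω ≤ 3) :
    ∃ C : ℝ, 0 < C ∧ ∀ (K : Type*) [Field K], MatMulIn K ω c → ∀ n s : ℕ, 1 ≤ s →
      -- quasiseparable matrix times vector
      (∀ σ : QSShape n s, ∃ P : SLP K (QSEntry σ ⊕ Fin n) (Fin n),
        (P.size : ℝ) ≤ C * (n * s) ∧
        ∀ X M, IsCompactBruhat σ X M → ∀ v : Fin n → K,
          P.Outputs (Sum.elim X v) (M.mulVec v)) ∧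
      -- quasiseparable matrix times dense `n × m` matrix, `m ≥ s`
      (∀ (σ : QSShape n s) (m : ℕ), s ≤ m →
        ∃ P : SLP K (QSEntry σ ⊕ (Fin n × Fin m)) (Fin n × Fin m),
          (P.size : ℝ) ≤ C * ((s : ℝ) ^ (ω - 2) * n * m) ∧
          ∀ X M, IsCompactBruhat σ X M → ∀ B : Matrix (Fin n) (Fin m) K,
            P.Outputs (Sum.elim X (entries B)) (entries (M * B))) ∧
      -- quasiseparable matrix times tall and skinny `n × t` matrix, `t ≤ s`
      (∀ (σ : QSShape n s) (t : ℕ), t ≤ s →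
        ∃ P : SLP K (QSEntry σ ⊕ (Fin n × Fin t)) (Fin n × Fin t),
          (P.size : ℝ) ≤ C * (s * (t : ℝ) ^ (ω - 2) * n) ∧
          ∀ X M, IsCompactBruhat σ X M → ∀ B : Matrix (Fin n) (Fin t) K,
            P.Outputs (Sum.elim X (entries B)) (entries (M * B))) ∧
      -- product of two quasiseparable matrices
      (∀ σ τ : QSShape n s, ∃ P : SLP K (QSEntry σ ⊕ QSEntry τ) (Fin n × Fin n),
        (P.size : ℝ) ≤ C * ((s : ℝ) ^ (ω - 2) * (n : ℝ) ^ 2) ∧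
        ∀ X M, IsCompactBruhat σ X M → ∀ Y N, IsCompactBruhat τ Y N →
          P.Outputs (Sum.elim X Y) (entries (M * N))) ∧
      -- left triangular matrix times dense `n × t` matrix, `t ≤ s` and `t ≥ s`
      (∀ (σ : CBShape n s) (t : ℕ),
        ∃ P : SLP K (CBEntry σ ⊕ (Fin n × Fin t)) (Fin n × Fin t),
          (t ≤ s → (P.size : ℝ) ≤ C * (s * (t : ℝ) ^ (ω - 2) * n)) ∧
          (s ≤ t → (P.size : ℝ) ≤ C * (n * t * (s : ℝ) ^ (ω - 2))) ∧
          ∀ X A, IsLeftCompactBruhat σ X A → ∀ B : Matrix (Fin n) (Fin t) K,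
            P.Outputs (Sum.elim X (entries B)) (entries (A * B))) := by
  -- The constant is chosen before `K`, whereas `0 ≤ c` follows only from `MatMulIn`; hence the
  -- absolute value. The factor `2` serves the product of two quasiseparable matrices.
  refine ⟨2 * (448 * |c| + 137), by positivity, fun K _ hM n s hs => ?_⟩
  have hc : |c| = c := abs_of_nonneg hM.nonneg
  rw [hc]
  have hc0 := hM.nonneg
  have bound : ∀ {t a b : ℕ} {x d : ℝ}, d ≤ 2 * (448 * c + 137) → x ≤ d * productCost ω n s t →
      max (min s n) t ≤ a → min (min s n) t ≤ b →
      x ≤ 2 * (448 * c + 137) * (n * a * (b : ℝ) ^ (ω - 2)) := fun hd hx ha hb =>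
    hx.trans (mul_le_mul hd (productCost_le hω2 ha hb) (productCost_nonneg _ _ _ _) (by linarith))
  have hd₁ : 448 * c + 137 ≤ 2 * (448 * c + 137) := by linarith
  have hd₂ : 224 * c + 67 ≤ 2 * (448 * c + 137) := by linarith
  refine ⟨fun σ => ?_, fun σ m hm => ?_, fun σ t ht => ?_, fun σ τ => ?_, fun σ t => ?_⟩
  · obtain ⟨P, hP, hout⟩ := exists_slp_compactBruhat_mul_vec hM hω2 hs σ
    refine ⟨P, ?_, hout⟩
    simpa using bound hd₁ hP (a := s) (b := 1) (by omega) (by omega)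
  · obtain ⟨P, hP, hout⟩ := exists_slp_compactBruhat_mul hM hω2 hs σ m
    refine ⟨P, (bound hd₁ hP (a := m) (b := s) (by omega) (by omega)).trans_eq (by ring), hout⟩
  · obtain ⟨P, hP, hout⟩ := exists_slp_compactBruhat_mul hM hω2 hs σ t
    refine ⟨P, (bound hd₁ hP (a := s) (b := t) (by omega) (by omega)).trans_eq (by ring), hout⟩
  · obtain ⟨P, hP, hout⟩ := exists_slp_compactBruhat_mul_compactBruhat hM hω2 hs σ τ
    rw [← mul_assoc] at hP
    -- Here `max (min s n) n = n` even when `s > n`, because `productCost` caps `s` at `n`.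
    refine ⟨P, (bound le_rfl hP (a := n) (b := s) (by omega) (by omega)).trans_eq (by ring), hout⟩
  · obtain ⟨P, hP, hout⟩ := exists_slp_leftCompactBruhat_mul hM hω2 hs σ t
    refine ⟨P, fun ht => ?_, fun ht => ?_, hout⟩
    · exact (bound hd₂ hP (a := s) (b := t) (by omega) (by omega)).trans_eq (by ring)
    · exact (bound hd₂ hP (a := t) (b := s) (by omega) (by omega)).trans_eq (by ring)
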